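/- Let $\Omega\subset\mathbb{R}^3$ be a bounded domain (non-empty, open, connected), and let $V\in L^\infty(\mathbb{R}^3)$ be real-valued with $\operatorname{supp} V=\overline{\Omega}$ and $V\ge\delta$ a.e. in $\overline{\Omega}$ for some constant $\delta>0$. Let $P_0=\Delta^2$, and let $H^{P_0}_0(\Omega)\subset L^2(\Omega)$ be the completion of $C_0^\infty(\Omega)$ with respect to the norm $\varphi\mapsto\|\Delta^2\varphi\|_{L^2}$. Call $\lambda\in\mathbb{C}$ a transmission eigenvalue if there are complex-valued functions $0\ne v\in L^2_{\mathrm{loc}}(\Omega)$ and $0\ne w\in L^2_{\mathrm{loc}}(\Omega)$ such that $$(\Delta^2-\lambda)v=0\ \text{ in }\Omega,\qquad (\Delta^2-\lambda(1+V))w=0\ \text{ in }\Omega,\qquad v-w\in H^{P_0}_0(\Omega),$$ where the equations are understood in the sense of distributions. Then the set of real transmission eigenvalues is infinite. -/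

import Mathlib

open MeasureTheory Filter Topology
open scoped ContDiff

noncomputable section

namespace Biharmonic

/-- Euclidean three-space. -/
abbrev R3 : Type := EuclideanSpace ℝ (Fin 3)

/-- `φ ∈ C₀^∞(Ω)`, complex-valued. -/
structure IsTestFunction (Ω : Set R3) (φ : R3 → ℂ) : Prop where
  smooth : ContDiff ℝ ∞ φ
  compact : HasCompactSupport φ
  subset : tsupport φ ⊆ Ω

/-- The biharmonic operator `P₀ = Δ²` on (smooth) functions on three-space. -/
def bilaplacian (φ : R3 → ℂ) : R3 → ℂ :=
  (Laplacian.laplacian (Laplacian.laplacian φ : R3 → ℂ) : R3 → ℂ)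

/-- The norm `‖φ‖_{P₀} = ‖Δ² φ‖_{L²}` on test functions. -/
def normP (φ : R3 → ℂ) : ENNReal :=
  eLpNorm (bilaplacian φ) 2 volume

/-- `u ∈ L²_loc(Ω)`. -/
def MemL2Loc (Ω : Set R3) (u : R3 → ℂ) : Prop :=
  ∀ K : Set R3, IsCompact K → K ⊆ Ω → MemLp u 2 (volume.restrict K)

/-- `u` (as a function on `Ω`) belongs to `H₀^{P₀}(Ω)`, the completion of `C₀^∞(Ω)` with respect to
`‖·‖_{P₀}`. Because `‖φ‖ ≤ C ‖φ‖_{P₀}` on `C₀^∞(Ω)` and `P₀` is closable, the completion is the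
space of the `L²(Ω)`-limits of the `‖·‖_{P₀}`-Cauchy sequences of test functions. -/
def MemH0 (Ω : Set R3) (u : R3 → ℂ) : Prop :=
  MemLp u 2 (volume.restrict Ω) ∧
  ∃ φ : ℕ → R3 → ℂ,
    (∀ j, IsTestFunction Ω (φ j)) ∧
    (∀ η : ENNReal, 0 < η → ∃ N : ℕ, ∀ j ≥ N, ∀ k ≥ N, normP (φ j - φ k) < η) ∧
    Tendsto (fun j => eLpNorm (φ j - u) 2 (volume.restrict Ω)) atTop (𝓝 0)

/-- `(P₀ - q) u = 0` in the sense of distributions in `Ω`, where `q` is multiplication by a bounded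
function (`P₀ = Δ²` is its own transpose). -/
def SolvesWeakly (Ω : Set R3) (q : R3 → ℂ) (u : R3 → ℂ) : Prop :=
  ∀ φ : R3 → ℂ, IsTestFunction Ω φ →
    ∫ x in Ω, u x * (bilaplacian φ x - q x * φ x) = 0

/-- `lam` is a transmission eigenvalue of the acoustic-type interior transmission problem for
`P₀ = Δ²` in `Ω` with potential `V`:
`(P₀ - lam) v = 0` and `(P₀ - lam (1 + V)) w = 0` in `Ω`, `v - w ∈ H₀^{P₀}(Ω)`,
with `v, w ∈ L²_loc(Ω)` both non-zero. -/
def IsTransmissionEigenvalue (Ω : Set R3) (V : R3 → ℝ) (lam : ℂ) : Prop :=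
  ∃ v w : R3 → ℂ,
    MemL2Loc Ω v ∧ MemL2Loc Ω w ∧
    ¬ (v =ᵐ[volume.restrict Ω] 0) ∧ ¬ (w =ᵐ[volume.restrict Ω] 0) ∧
    SolvesWeakly Ω (fun _ => lam) v ∧
    SolvesWeakly Ω (fun x => lam * (1 + (V x : ℂ))) w ∧
    MemH0 Ω (v - w)

/-- The support of an almost-everywhere-defined function: the complement of the largest open set on
which it vanishes almost everywhere. -/
def essSupport (V : R3 → ℝ) : Set R3 :=
  {x | ∀ U : Set R3, IsOpen U → x ∈ U → ¬ (V =ᵐ[volume.restrict U] 0)}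

end Biharmonic

end

/-! Put `P = Δ²` and `h = v - w`, with `t > 0` real. Subtracting the equations gives `(P - t) h = -t
V w`, so `w` is recovered from `h`, and the problem becomes the single fourth-order-squared equation
`(P - t) V⁻¹ (P - t) h = t (P - t) h` with `h ∈ H₀^P(Ω)`. Its quadratic form `⟨V⁻¹ (P - t) h, (P -
t) h⟩ - t ⟨(P - t) h, h⟩` is represented by a self-adjoint operator `pencil W t` on the graph space,
norm-continuous in `t`.

Since `V⁻¹` is bounded below, the form is coercive up to a multiple of `‖h‖²_{L²}`
(`pencil_garding`), and the inclusion into `L²` is compact (`graphI_smallOnFiniteCodim`). Hence the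
negative index is finite for each `t`, and an operator without kernel is invertible. Near an
invertible operator the negative index does not change, so if it is unbounded as `t` grows, kernels
must occur beyond every `t₀` (`exists_ge_ker_ne_bot`).

Unboundedness comes from high frequency. For `u = exp(i k x₀) f` one has `P u ≈ k⁴ u`; choosing `k⁴
= t (1 + δ/2)` and using `V⁻¹ ≤ δ⁻¹`, the form is at most about `(δ/4 - δ/2) t² ‖u‖² < 0`, and `f`
may range over a space of any finite dimension (`exists_ge_negIndexGE_pencil`).

A null vector `h ≠ 0` yields `w` and `v = h + w`. If either vanished, then `|P h| ≤ q |h|` for a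
constant `q`, and a Carleman estimate for the extension of `h` by zero would force `h = 0`
(`eq_zero_of_norm_graphP_le`). -/

namespace Biharmonic

/-! ### Negative index and degeneration in self-adjoint families -/

section Spectral

variable {H : Type*} [NormedAddCommGroup H] [InnerProductSpace ℂ H]
variable {L : Type*} [NormedAddCommGroup L] [InnerProductSpace ℂ L]

/-- The quadratic form of `S` is negative definite on the image of a `k`-dimensional space. -/
def NegIndexGE (k : ℕ) (S : H →L[ℂ] H) : Prop :=
  ∃ ℓ : (Fin k → ℂ) →ₗ[ℂ] H, ∀ c, c ≠ 0 → (inner ℂ (S (ℓ c)) (ℓ c)).re < 0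

/-- `U` is small on subspaces of finite codimension. -/
def SmallOnFiniteCodim (U : H →L[ℂ] L) : Prop :=
  ∀ ε > 0, ∃ F : Submodule ℂ H, FiniteDimensional ℂ F ∧ ∀ x ∈ Fᗮ, ‖U x‖ ≤ ε * ‖x‖

/-- Composing `U` with the projection onto `F` gives finite-rank operators that converge to `U` in
norm. -/
theorem SmallOnFiniteCodim.isCompactOperator [CompleteSpace L] {U : H →L[ℂ] L}
    (hU : SmallOnFiniteCodim U) : IsCompactOperator U := by
  refine (isClosed_setOfPred_isCompactOperator (σ₁₂ := RingHom.id ℂ)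
    (M₁ := H) (M₂ := L)).closure_subset (a := U) ?_
  refine Metric.mem_closure_iff.2 fun ε hε => ?_
  obtain ⟨F, hF, hFU⟩ := hU (ε / 2) (by positivity)
  refine ⟨U ∘L F.starProjection, ?_, ?_⟩
  · change IsCompactOperator (U ∘L F.starProjection)
    have h1 : IsCompactOperator (F.orthogonalProjectionOnto : H →L[ℂ] F) :=
      ⟨Metric.closedBall 0 1, isCompact_closedBall _ _,
        (F.orthogonalProjectionOnto).continuous.continuousAt.preimage_mem_nhds
          (by simpa using Metric.closedBall_mem_nhds (0 : F) one_pos)⟩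
    exact h1.clm_comp (U ∘L F.subtypeL)
  · rw [dist_eq_norm]
    refine lt_of_le_of_lt (ContinuousLinearMap.opNorm_le_bound _ (by positivity) fun x => ?_)
      (half_lt_self hε)
    have h2 := hFU (x - F.starProjection x) (F.sub_starProjection_mem_orthogonal x)
    have h3 : ‖x - F.starProjection x‖ ≤ ‖x‖ := by
      rw [← Submodule.starProjection_orthogonal_val]
      exact Fᗮ.norm_starProjection_apply_le x
    calc ‖(U - U ∘L F.starProjection) x‖ = ‖U (x - F.starProjection x)‖ := by simp
      _ ≤ ε / 2 * ‖x - F.starProjection x‖ := h2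
      _ ≤ _ := by gcongr

/-- A Gårding inequality bounds the negative index. -/
theorem SmallOnFiniteCodim.exists_not_negIndexGE {U : H →L[ℂ] L} (hU : SmallOnFiniteCodim U)
    {S : H →L[ℂ] H} {c C : ℝ} (hc : 0 < c)
    (hS : ∀ x, c * ‖x‖ ^ 2 ≤ (inner ℂ (S x) x).re + C * ‖U x‖ ^ 2) :
    ∃ k, ¬ NegIndexGE k S := by
  obtain ⟨ε, hε, hεC⟩ : ∃ ε > 0, |C| * ε ^ 2 ≤ c := by
    refine ⟨√(c / (|C| + 1)), by positivity, ?_⟩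
    rw [Real.sq_sqrt (by positivity), mul_div_assoc', div_le_iff₀ (by positivity)]
    nlinarith [abs_nonneg C]
  obtain ⟨F, hF, hFU⟩ := hU ε hε
  refine ⟨Module.finrank ℂ F + 1, ?_⟩
  rintro ⟨ℓ, hℓ⟩
  -- A negative space of dimension greater than `dim F` meets `Fᗮ`, where the choice of `ε` makes
  -- the form nonnegative.
  have hker : ((F.orthogonalProjectionOnto : H →ₗ[ℂ] F) ∘ₗ ℓ).ker ≠ ⊥ :=
    LinearMap.ker_ne_bot_of_finrank_lt (by simp)
  obtain ⟨v, hv, hv0⟩ := (Submodule.ne_bot_iff _).1 hker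
  have hv' : ℓ v ∈ Fᗮ := by
    rw [← F.ker_orthogonalProjectionOnto]
    simpa using hv
  have h1 := hℓ v hv0
  have h2 := hS (ℓ v)
  have h3 := hFU _ hv'
  have h4 : C * ‖U (ℓ v)‖ ^ 2 ≤ |C| * (ε * ‖ℓ v‖) ^ 2 := by
    gcongr
    exact le_abs_self C
  nlinarith [mul_le_mul_of_nonneg_right hεC (sq_nonneg ‖ℓ v‖)]

variable [CompleteSpace H]

/-- Fredholm alternative for operators satisfying a Gårding inequality. -/
theorem SmallOnFiniteCodim.isUnit_of_ker_eq_bot [CompleteSpace L] {U : H →L[ℂ] L} (hU : SmallOnFiniteCodim U)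
    {S : H →L[ℂ] H} {c C : ℝ} (hc : 0 < c)
    (hS : ∀ x, c * ‖x‖ ^ 2 ≤ (inner ℂ (S x) x).re + C * ‖U x‖ ^ 2)
    (hker : ∀ x, S x = 0 → x = 0) : IsUnit S := by
  -- `S + K` is coercive, hence invertible, and `K` is compact. So `S = A (1 - A⁻¹ K)`, and the
  -- Fredholm alternative applies to `A⁻¹ K` at the value `1`.
  set K : H →L[ℂ] H := (C : ℂ) • (ContinuousLinearMap.adjoint U ∘L U) with hK
  have hA : IsUnit (S + K) := by
    refine ContinuousLinearMap.isUnit_of_forall_le_norm_inner_map (c := ⟨c, hc.le⟩) _ hc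
      fun x => ?_
    refine le_trans ?_ (Complex.re_le_norm _)
    have : (inner ℂ ((S + K) x) x).re = (inner ℂ (S x) x).re + C * ‖U x‖ ^ 2 := by
      simp only [hK, add_apply, smul_apply,
        ContinuousLinearMap.comp_apply, inner_add_left, inner_smul_left,
        ContinuousLinearMap.adjoint_inner_left, inner_self_eq_norm_sq_to_K, Complex.conj_ofReal,
        Complex.add_re]
      norm_cast
      rw [Complex.re_ofReal_mul]; rfl
    rw [this, mul_comm]
    exact hS x
  obtain ⟨A, hA⟩ := hA
  have hcomp : IsCompactOperator ((A⁻¹ : (H →L[ℂ] H)ˣ) * K : H →L[ℂ] H) := by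
    have h1 := hU.isCompactOperator.clm_comp (((A⁻¹ : (H →L[ℂ] H)ˣ) : H →L[ℂ] H) ∘L
      ((C : ℂ) • ContinuousLinearMap.adjoint U))
    refine cast (congrArg _ (funext fun x => ?_)) h1
    simp [hK]
  have hSA : S = A * (1 - (A⁻¹ : (H →L[ℂ] H)ˣ) * K) := by
    rw [mul_sub, ← mul_assoc, Units.mul_inv, hA]
    simp
  rcases hcomp.hasEigenvalue_or_mem_resolventSet (μ := 1) one_ne_zero with h | h
  · obtain ⟨x, hx, hx0⟩ := h.exists_hasEigenvector
    refine absurd (hker x ?_) hx0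
    have hx' : ((A⁻¹ : (H →L[ℂ] H)ˣ) * K : H →L[ℂ] H) x = x := by
      simpa using Module.End.mem_eigenspace_iff.1 hx
    rw [hSA, mul_apply_eq_comp, sub_apply, hx']
    simp
  · rw [hSA]
    refine A.isUnit.mul ?_
    simpa [spectrum.mem_resolventSet_iff] using h

/-- An invertible self-adjoint operator is definite on the kernel and on the range of a spectral
projection. -/
theorem exists_definite_splitting {T : H →L[ℂ] H} (hT : IsSelfAdjoint T) (hu : IsUnit T) :
    ∃ c > 0, ∃ Q : H →L[ℂ] H, (∀ x, Q (Q x) = Q x) ∧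
      (∀ x, Q x = 0 → c * ‖x‖ ^ 2 ≤ (inner ℂ (T x) x).re) ∧
      (∀ x, Q x = x → (inner ℂ (T x) x).re ≤ -c * ‖x‖ ^ 2) := by
  have h0 : (0 : ℝ) ∉ spectrum ℝ T := spectrum.zero_notMem ℝ hu
  obtain ⟨c, hc, hcs⟩ : ∃ c > 0, ∀ x ∈ spectrum ℝ T, c ≤ |x| := by
    have hcl : IsClosed (spectrum ℝ T) := spectrum.isClosed T
    obtain ⟨c, hc, hb⟩ := Metric.isOpen_iff.1 hcl.isOpen_compl 0 h0
    refine ⟨c, hc, fun x hx => ?_⟩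
    by_contra! hlt
    exact hb (by simpa using hlt) hx
  have hne : ∀ x ∈ spectrum ℝ T, x ≠ 0 := fun x hx h => h0 (h ▸ hx)
  -- The jump at `0` lies in a spectral gap, so the continuous functional calculus produces the
  -- negative spectral projection.
  set q : ℝ → ℝ := fun x => if x < 0 then 1 else 0 with hq
  have hqc : ContinuousOn q (spectrum ℝ T) := by
    intro x hx
    refine ContinuousAt.continuousWithinAt ?_
    rcases lt_or_gt_of_ne (hne x hx) with h | h
    · exact (continuousAt_const (y := (1 : ℝ))).congr
        (by filter_upwards [Iio_mem_nhds h] with y hy using by simp [hq, Set.mem_Iio.1 hy])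
    · exact (continuousAt_const (y := (0 : ℝ))).congr
        (by filter_upwards [Ioi_mem_nhds h] with y hy using by simp [hq, (Set.mem_Ioi.1 hy).le])
  have hid : ContinuousOn (fun x : ℝ => x) (spectrum ℝ T) := continuousOn_id
  set Q : H →L[ℂ] H := cfc q T with hQ
  have hQQ : Q * Q = Q := by
    rw [hQ, ← cfc_mul q q T hqc hqc]
    exact cfc_congr fun x _ => by simp [hq]
  have hcQ : cfc (fun x => c * q x) T = c • Q := cfc_const_mul c q T hqc
  have hTQ : cfc (fun x => x * q x) T = T * Q := by
    rw [cfc_mul (fun x => x) q T hid hqc, cfc_id' ℝ T]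
  have hneg : T * Q ≤ -(c • Q) := by
    rw [← hTQ, ← hcQ, ← cfc_neg (fun x => c * q x) T]
    refine cfc_mono (fun x hx => ?_) (hid.mul hqc) (hqc.const_mul c).neg
    have := hcs x hx
    by_cases h : x < 0
    · rw [abs_of_neg h] at this
      simp only [hq, h, if_true]
      linarith
    · simp [hq, h]
  have hpos : c • (1 - Q) ≤ T - T * Q := by
    have e1 : cfc (fun x => x - x * q x) T = T - T * Q := by
      rw [cfc_sub (fun x => x) (fun x => x * q x) T hid (hid.mul hqc), cfc_id' ℝ T, hTQ]
    have e2 : cfc (fun x => c - c * q x) T = c • (1 - Q) := by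
      rw [cfc_sub (fun _ => c) (fun x => c * q x) T continuousOn_const (hqc.const_mul c), hcQ,
        cfc_const c T, smul_sub, Algebra.algebraMap_eq_smul_one]
    rw [← e1, ← e2]
    refine cfc_mono (fun x hx => ?_) (continuousOn_const.sub (hqc.const_mul c))
      (hid.sub (hid.mul hqc))
    have := hcs x hx
    by_cases h : x < 0
    · simp [hq, h]
    · rw [abs_of_nonneg (not_lt.1 h)] at this
      simpa [hq, h] using this
  have hre : ∀ x : H, (inner ℂ (c • x) x).re = c * ‖x‖ ^ 2 := fun x => by
    rw [← Complex.coe_smul, inner_smul_left, inner_self_eq_norm_sq_to_K, Complex.conj_ofReal]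
    norm_cast
    rw [Complex.re_ofReal_mul]; rfl
  refine ⟨c, hc, Q, fun x => by rw [← mul_apply_eq_comp, hQQ], fun x hx => ?_,
    fun x hx => ?_⟩
  · have := ((ContinuousLinearMap.le_def _ _).1 hpos).re_inner_nonneg_left x
    simp only [sub_apply, mul_apply_eq_comp, hx,
      smul_apply, one_apply_eq_self, map_zero, sub_zero,
      inner_sub_left, map_sub, RCLike.re_to_complex, hre] at this
    linarith
  · have := ((ContinuousLinearMap.le_def _ _).1 hneg).re_inner_nonneg_left x
    simp only [sub_apply, mul_apply_eq_comp, hx,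
      smul_apply, neg_apply,
      inner_sub_left, inner_neg_left, map_sub, map_neg, RCLike.re_to_complex, hre] at this
    linarith

/-- Near an invertible self-adjoint operator the negative index is constant. -/
theorem exists_ball_negIndexGE_iff {T : H →L[ℂ] H} (hT : IsSelfAdjoint T) (hu : IsUnit T) :
    ∃ r > 0, ∀ S : H →L[ℂ] H, ‖S - T‖ < r → ∀ k, NegIndexGE k S ↔ NegIndexGE k T := by
  obtain ⟨c, hc, Q, hQQ, hpos, hneg⟩ := exists_definite_splitting hT hu
  have hdiff : ∀ S : H →L[ℂ] H, ‖S - T‖ < c → ∀ x, x ≠ 0 →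
      |(inner ℂ (S x) x).re - (inner ℂ (T x) x).re| < c * ‖x‖ ^ 2 := by
    intro S hS x hx
    have hx' : 0 < ‖x‖ := norm_pos_iff.2 hx
    rw [← Complex.sub_re, ← inner_sub_left, ← sub_apply]
    calc |(inner ℂ ((S - T) x) x).re| ≤ ‖inner ℂ ((S - T) x) x‖ := Complex.abs_re_le_norm _
      _ ≤ ‖(S - T) x‖ * ‖x‖ := norm_inner_le_norm _ _
      _ ≤ ‖S - T‖ * ‖x‖ * ‖x‖ := by gcongr; exact ContinuousLinearMap.le_opNorm _ _
      _ < c * ‖x‖ * ‖x‖ := by gcongr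
      _ = _ := by ring
  have key : ∀ S S' : H →L[ℂ] H, ‖S - T‖ < c → ‖S' - T‖ < c → ∀ k, NegIndexGE k S →
      NegIndexGE k S' := by
    rintro S S' hS hS' k ⟨ℓ, hℓ⟩
    -- `S` stays positive on the kernel of `Q`, so `Q` kills no nonzero vector of a negative space
    -- of `S`; on the range of `Q` the form of `S'` stays negative.
    refine ⟨(Q : H →ₗ[ℂ] H) ∘ₗ ℓ, fun v hv => ?_⟩
    have hlv : ℓ v ≠ 0 := fun h => by simpa [h] using hℓ v hv
    have h0 : Q (ℓ v) ≠ 0 := fun h => by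
      have h1 := hpos _ h
      have h2 := abs_lt.1 (hdiff S hS _ hlv)
      have h3 := hℓ v hv
      linarith [h2.1]
    have h1 := hneg _ (hQQ (ℓ v))
    have h2 := abs_lt.1 (hdiff S' hS' _ h0)
    simp only [LinearMap.comp_apply, ContinuousLinearMap.coe_coe]
    linarith [h2.2]
  exact ⟨c, hc, fun S hS k =>
    ⟨key S T hS (by simpa using hc) k, key T S (by simpa using hc) hS k⟩⟩

/-- Along a continuous family of self-adjoint operators satisfying Gårding inequalities, an
unbounded negative index forces degenerate operators for arbitrarily large parameters. -/
theorem exists_ge_ker_ne_bot [CompleteSpace L] {U : H →L[ℂ] L} (hU : SmallOnFiniteCodim U)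
    {T : ℝ → H →L[ℂ] H} (hcont : Continuous T) (hT : ∀ t, IsSelfAdjoint (T t))
    (hgard : ∀ t, ∃ c > 0, ∃ C, ∀ x, c * ‖x‖ ^ 2 ≤ (inner ℂ (T t x) x).re + C * ‖U x‖ ^ 2)
    (hneg : ∀ k t₀, ∃ t ≥ t₀, NegIndexGE k (T t)) (t₀ : ℝ) :
    ∃ t ≥ t₀, ∃ x, x ≠ 0 ∧ T t x = 0 := by
  by_contra! hcon
  have hunit : ∀ t ≥ t₀, IsUnit (T t) := fun t ht => by
    obtain ⟨c, hc, C, h⟩ := hgard t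
    exact hU.isUnit_of_ker_eq_bot hc h fun x hx => by
      by_contra h0
      exact hcon t ht x h0 hx
  obtain ⟨c, hc, C, h⟩ := hgard t₀
  obtain ⟨k, hk⟩ := hU.exists_not_negIndexGE hc h
  obtain ⟨t, ht, hkt⟩ := hneg k t₀
  set f : Set.Ici t₀ → Prop := fun s => NegIndexGE k (T s) with hf
  have hloc : IsLocallyConstant f := by
    rw [IsLocallyConstant.iff_eventually_eq]
    intro s
    obtain ⟨r, hr, hrs⟩ := exists_ball_negIndexGE_iff (hT s) (hunit s s.2)
    have hcs : Continuous fun s' : Set.Ici t₀ => T s' := hcont.comp continuous_subtype_val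
    filter_upwards [hcs.continuousAt.preimage_mem_nhds (Metric.ball_mem_nhds _ hr)] with s' hs'
    exact propext (hrs _ (by simpa [dist_eq_norm] using hs') k)
  have hpre : IsPreconnected (Set.univ : Set (Set.Ici t₀)) :=
    Subtype.preconnectedSpace isPreconnected_Ici |>.isPreconnected_univ
  have := hloc.apply_eq_of_isPreconnected hpre (x := ⟨t, ht⟩) (y := ⟨t₀, Set.self_mem_Ici⟩) trivial trivial
  exact hk (this.mp hkt)

end Spectral

/-! ### Fourier-side and integration-by-parts estimates for Schwartz functions -/

section SchwartzEstimates

open SchwartzMap FourierTransform LineDeriv Laplacian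
open scoped SchwartzMap

/-- The first unit vector. -/
noncomputable def e0 : R3 := EuclideanSpace.single 0 1

/-- Square-integrable functions on three-space. -/
abbrev L2 : Type := Lp ℂ 2 (volume : Measure R3)

/-- A Schwartz function as an element of `L²`. -/
noncomputable def toL2 : 𝓢(R3, ℂ) →ₗ[ℂ] L2 :=
  ((toLpCLM ℂ ℂ 2 volume : 𝓢(R3, ℂ) →L[ℂ] L2) : 𝓢(R3, ℂ) →ₗ[ℂ] L2)

theorem toL2_eq (f : 𝓢(R3, ℂ)) : toL2 f = f.toLp 2 volume := rfl

theorem norm_toL2_fourier (f : 𝓢(R3, ℂ)) : ‖toL2 (𝓕 f)‖ = ‖toL2 f‖ :=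
  norm_fourier_toL2_eq f

theorem coeFn_toL2 (f : 𝓢(R3, ℂ)) : toL2 f =ᵐ[volume] f := f.coeFn_toLp 2 volume

theorem norm_toL2_le_of_norm_le {f g : 𝓢(R3, ℂ)} {c : ℝ} (h : ∀ x, ‖f x‖ ≤ c * ‖g x‖) :
    ‖toL2 f‖ ≤ c * ‖toL2 g‖ := by
  refine Lp.norm_le_mul_norm_of_ae_le_mul ?_
  filter_upwards [coeFn_toL2 f, coeFn_toL2 g] with x hf hg
  rw [hf, hg]
  exact h x

theorem fourier_sub (f g : 𝓢(R3, ℂ)) : 𝓕 (f - g) = 𝓕 f - 𝓕 g :=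
  map_sub (FourierTransform.fourierCLM ℂ 𝓢(R3, ℂ)) f g

theorem fourier_lineDeriv_apply (f : 𝓢(R3, ℂ)) (m ξ : R3) :
    𝓕 (∂_{m} f) ξ = (2 * Real.pi * Complex.I) * (inner ℝ ξ m : ℝ) * 𝓕 f ξ := by
  have h : (inner ℝ · m : R3 → ℝ).HasTemperateGrowth := by fun_prop
  rw [fourier_lineDerivOp_eq]
  simp [h, mul_assoc]

theorem fourier_laplacian_apply (f : 𝓢(R3, ℂ)) (ξ : R3) :
    𝓕 (Δ f) ξ = (-((2 * Real.pi) ^ 2 * ‖ξ‖ ^ 2) : ℝ) * 𝓕 f ξ := by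
  have h : (fun x : R3 => ‖x‖ ^ 2).HasTemperateGrowth := by fun_prop
  rw [laplacian_eq_fourierMultiplierCLM]
  rw [FourierTransform.fourier_smul, fourierMultiplierCLM_apply,
    FourierTransform.fourier_fourierInv_eq]
  change (-(2 * Real.pi) ^ 2) • (smulLeftCLM ℂ (fun x : R3 => ‖x‖ ^ 2) (𝓕 f)) ξ = _
  rw [smulLeftCLM_apply_apply h]
  simp only [Complex.real_smul]
  push_cast
  ring

theorem inner_lineDeriv_right (f g : 𝓢(R3, ℂ)) (m : R3) :
    inner ℂ (toL2 f) (toL2 (∂_{m} g)) = -inner ℂ (toL2 (∂_{m} f)) (toL2 g) := by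
  rw [toL2_eq, toL2_eq, toL2_eq, toL2_eq, inner_toL2_toL2_eq (μ := volume),
    inner_toL2_toL2_eq (μ := volume)]
  have := integral_bilinear_lineDerivOp_right_eq_neg_left (μ := volume) f g
    ((ContinuousLinearMap.mul ℝ ℂ).comp (Complex.conjCLE : ℂ →L[ℝ] ℂ)) m
  simpa [mul_comm] using this

theorem inner_laplacian_right (f g : 𝓢(R3, ℂ)) :
    inner ℂ (toL2 f) (toL2 (Δ g)) = inner ℂ (toL2 (Δ f)) (toL2 g) := by
  rw [toL2_eq, toL2_eq, toL2_eq, toL2_eq, inner_toL2_toL2_eq (μ := volume),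
    inner_toL2_toL2_eq (μ := volume)]
  have := integral_bilinear_laplacian_right_eq_left (μ := volume) f g
    ((ContinuousLinearMap.mul ℝ ℂ).comp (Complex.conjCLE : ℂ →L[ℝ] ℂ))
  simpa [mul_comm] using this

/-- Sobolev embedding `H² ⊆ L^∞` in three dimensions. -/
theorem exists_sup_le :
    ∃ C, 0 ≤ C ∧ ∀ (f : 𝓢(R3, ℂ)) (x : R3), ‖f x‖ ≤ C * ‖toL2 (f - Δ f)‖ := by
  -- Bound `f` by the `L¹` norm of its Fourier transform and apply Cauchy-Schwarz with this weight;
  -- its square decays like `‖ξ‖⁻⁴`, integrable because `4 > 3`.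
  set w : R3 → ℝ := fun ξ => (1 + ‖ξ‖ ^ 2)⁻¹ with hw
  have hwpos : ∀ ξ, 0 ≤ w ξ := fun ξ => by positivity
  have hw2 : MemLp w 2 volume := by
    rw [memLp_two_iff_integrable_sq (by fun_prop)]
    refine (integrable_rpow_neg_one_add_norm_sq (E := R3) (r := 4) (by simp; norm_num)).congr ?_
    filter_upwards with ξ
    rw [hw, show (-4 / 2 : ℝ) = -((2 : ℕ) : ℝ) by norm_num, Real.rpow_neg (by positivity),
      Real.rpow_natCast, inv_pow]
  refine ⟨(∫ ξ, w ξ ^ (2 : ℝ)) ^ (1 / (2 : ℝ)), by positivity, fun f x => ?_⟩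
  set g := f - Δ f with hg
  have hFg : ∀ ξ, ‖𝓕 f ξ‖ ≤ w ξ * ‖𝓕 g ξ‖ := fun ξ => by
    have h1 : 𝓕 g ξ = ((1 + (2 * Real.pi) ^ 2 * ‖ξ‖ ^ 2 : ℝ) : ℂ) * 𝓕 f ξ := by
      rw [hg, fourier_sub, sub_apply, fourier_laplacian_apply]
      push_cast
      ring
    have h3 : 1 ≤ (2 * Real.pi) ^ 2 := by nlinarith [Real.pi_gt_three]
    rw [h1, norm_mul, Complex.norm_real, Real.norm_of_nonneg (by positivity), hw, inv_mul_eq_div,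
      le_div_iff₀ (by positivity), mul_comm]
    gcongr
    exact le_mul_of_one_le_left (by positivity) h3
  have h1 : ‖f x‖ ≤ ∫ ξ, ‖𝓕 f ξ‖ := by
    have e : f x = 𝓕 (𝓕 f) (-x) := by
      conv_lhs => rw [← FourierTransform.fourierInv_fourier_eq (F := 𝓢(R3, ℂ)) f]
      rw [fourierInv_apply_eq]
      simp
    rw [e]
    refine (norm_fourier_apply_le_toLp_one _ _).trans_eq ?_
    rw [norm_toLp_one]
  have hF2 : MemLp (fun ξ => ‖𝓕 g ξ‖) 2 volume := ((𝓕 g).memLp 2 volume).norm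
  have h2 : ∫ ξ, ‖𝓕 f ξ‖ ≤ ∫ ξ, w ξ * ‖𝓕 g ξ‖ :=
    integral_mono ((𝓕 f).integrable.norm) (hw2.integrable_mul hF2) hFg
  have h3 := integral_mul_le_Lp_mul_Lq_of_nonneg (μ := (volume : Measure R3)) (p := 2) (q := 2)
    Real.HolderConjugate.two_two
    (f := w) (g := fun ξ => ‖𝓕 g ξ‖) (ae_of_all _ hwpos) (ae_of_all _ fun _ => norm_nonneg _)
    (by simpa using hw2) (by simpa using hF2)
  have h4 : ‖toL2 g‖ = (∫ ξ, ‖𝓕 g ξ‖ ^ (2 : ℝ)) ^ (1 / (2 : ℝ)) := by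
    rw [← norm_toL2_fourier, toL2_eq, norm_toLp' (by simp) (by simp)]
    simp
  rw [h4]
  exact h1.trans (h2.trans h3)

/-- The Laplacian conjugated with `exp (τ x₀)` dominates the derivative in the first coordinate. -/
theorem norm_lineDeriv_le_conj_laplacian (τ : ℝ) (ψ : 𝓢(R3, ℂ)) :
    2 * |τ| * ‖toL2 (∂_{e0} ψ)‖ ≤
      ‖toL2 (Δ ψ - (2 * τ : ℂ) • ∂_{e0} ψ + (τ ^ 2 : ℂ) • ψ)‖ := by
  rw [← norm_toL2_fourier (∂_{e0} ψ),
    ← norm_toL2_fourier (Δ ψ - (2 * τ : ℂ) • ∂_{e0} ψ + (τ ^ 2 : ℂ) • ψ)]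
  have h2 : ‖((2 * |τ| : ℝ) : ℂ)‖ = 2 * |τ| := by
    rw [Complex.norm_real, Real.norm_of_nonneg (by positivity)]
  rw [← h2, ← norm_smul, ← map_smul]
  refine (norm_toL2_le_of_norm_le (c := 1) fun ξ => ?_).trans_eq (one_mul _)
  rw [FourierTransform.fourier_add, fourier_sub, FourierTransform.fourier_smul,
    FourierTransform.fourier_smul]
  simp only [add_apply, sub_apply, smul_apply,
    fourier_lineDeriv_apply, fourier_laplacian_apply, smul_eq_mul, one_mul]
  have e : ((-((2 * Real.pi) ^ 2 * ‖ξ‖ ^ 2) : ℝ) : ℂ) * 𝓕 ψ ξ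
      - 2 * τ * (2 * Real.pi * Complex.I * (inner ℝ ξ e0 : ℝ) * 𝓕 ψ ξ) + τ ^ 2 * 𝓕 ψ ξ
      = (((-((2 * Real.pi) ^ 2 * ‖ξ‖ ^ 2) + τ ^ 2 : ℝ) : ℂ)
        + ((-(2 * τ * (2 * Real.pi * inner ℝ ξ e0)) : ℝ) : ℂ) * Complex.I) * 𝓕 ψ ξ := by
    push_cast
    ring
  rw [e, ← mul_assoc, norm_mul, norm_mul, norm_mul _ (𝓕 ψ ξ)]
  refine mul_le_mul_of_nonneg_right ?_ (norm_nonneg (𝓕 ψ ξ))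
  -- Only the imaginary part of the conjugated symbol is kept: its modulus is `2 |τ|` times that of
  -- the symbol of `∂_{e0}`.
  refine le_trans (le_of_eq ?_) (Complex.abs_im_le_norm _)
  rw [Complex.add_im, Complex.ofReal_im, Complex.mul_I_im, Complex.ofReal_re, zero_add, abs_neg]
  simp only [Complex.norm_real, norm_mul, Complex.norm_I, Complex.norm_ofNat, Real.norm_eq_abs,
    abs_mul, abs_abs, abs_two, abs_of_pos Real.pi_pos]
  ring

/-- Poincaré inequality in a slab. -/
theorem norm_le_lineDeriv_of_slab {R : ℝ} (hR : 0 ≤ R) (ψ : 𝓢(R3, ℂ))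
    (hψ : ∀ x, ψ x ≠ 0 → |x 0| ≤ R) (hψ' : ∀ x, ∂_{e0} ψ x ≠ 0 → |x 0| ≤ R) :
    ‖toL2 ψ‖ ≤ 2 * R * ‖toL2 (∂_{e0} ψ)‖ := by
  have ht : (inner ℝ · e0 : R3 → ℝ).HasTemperateGrowth := by fun_prop
  have hin : ∀ x : R3, inner ℝ x e0 = x 0 := fun x => by
    simp [e0, EuclideanSpace.inner_single_right]
  -- Integrate by parts against `x₀`: from `∂(x₀ ψ) = ψ + x₀ ∂ψ`, `‖ψ‖² = -⟨∂ψ, x₀ ψ⟩ - ⟨ψ, x₀ ∂ψ⟩`,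
  -- and `|x₀| ≤ R` on the support.
  set g := smulLeftCLM ℂ (inner ℝ · e0 : R3 → ℝ) ψ with hg
  set k := smulLeftCLM ℂ (inner ℝ · e0 : R3 → ℝ) (∂_{e0} ψ) with hk
  have hgn : ‖toL2 g‖ ≤ R * ‖toL2 ψ‖ := norm_toL2_le_of_norm_le fun x => by
    rw [hg, smulLeftCLM_apply_apply ht, norm_smul, hin, Real.norm_eq_abs]
    by_cases h : ψ x = 0
    · simp [h]
    · gcongr; exact hψ x h
  have hkn : ‖toL2 k‖ ≤ R * ‖toL2 (∂_{e0} ψ)‖ := norm_toL2_le_of_norm_le fun x => by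
    rw [hk, smulLeftCLM_apply_apply ht, norm_smul, hin, Real.norm_eq_abs]
    by_cases h : ∂_{e0} ψ x = 0
    · simp [h]
    · gcongr; exact hψ' x h
  have hdg : ∂_{e0} g = ψ + k := by
    ext x
    rw [lineDerivOp_apply_eq_fderiv, add_apply, hk, smulLeftCLM_apply_apply ht, hg,
      smulLeftCLM_apply ht]
    have h1 : HasFDerivAt (fun x : R3 => inner ℝ x e0) ((innerSL ℝ).flip e0) x :=
      ((innerSL ℝ).flip e0).hasFDerivAt
    rw [(show fderiv ℝ (fun x => inner ℝ x e0 • ψ x) x = _ from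
      (h1.smul (ψ.hasFDerivAt x)).fderiv)]
    have h2 : innerSL ℝ e0 e0 = 1 := by simp [e0]
    simp [lineDerivOp_apply_eq_fderiv, h2, add_comm]
  have h1 := inner_lineDeriv_right ψ g e0
  rw [hdg, map_add, inner_add_right, inner_self_eq_norm_sq_to_K] at h1
  have h2 : ‖toL2 ψ‖ ^ 2 ≤ ‖toL2 (∂_{e0} ψ)‖ * ‖toL2 g‖ + ‖toL2 ψ‖ * ‖toL2 k‖ := by
    have h3 : ((‖toL2 ψ‖ : ℂ)) ^ 2 =
        -inner ℂ (toL2 (∂_{e0} ψ)) (toL2 g) - inner ℂ (toL2 ψ) (toL2 k) := by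
      linear_combination h1
    calc ‖toL2 ψ‖ ^ 2 = ‖((‖toL2 ψ‖ : ℂ)) ^ 2‖ := by simp
      _ ≤ ‖inner ℂ (toL2 (∂_{e0} ψ)) (toL2 g)‖ + ‖inner ℂ (toL2 ψ) (toL2 k)‖ := by
        rw [h3]
        exact (norm_sub_le _ _).trans_eq (by rw [norm_neg])
      _ ≤ _ := add_le_add (norm_inner_le_norm _ _) (norm_inner_le_norm _ _)
  rcases eq_or_lt_of_le (norm_nonneg (toL2 ψ)) with h0 | h0
  · rw [← h0]; positivity
  · refine le_of_mul_le_mul_left ?_ h0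
    nlinarith [mul_le_mul_of_nonneg_left hgn (norm_nonneg (toL2 (∂_{e0} ψ))),
      mul_le_mul_of_nonneg_left hkn (norm_nonneg (toL2 ψ))]

end SchwartzEstimates

/-! ### Test functions, exponential conjugation and Carleman estimates -/

section TestSpace

open SchwartzMap LineDeriv Laplacian
open scoped SchwartzMap

/-- `C₀^∞(Ω)` as a subspace of the Schwartz space. -/
def testSpace (Ω : Set R3) : Submodule ℂ 𝓢(R3, ℂ) where
  carrier := {f | HasCompactSupport f ∧ tsupport f ⊆ Ω}
  zero_mem' := by
    have : ((0 : 𝓢(R3, ℂ)) : R3 → ℂ) = 0 := rfl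
    simp [this, HasCompactSupport.zero]
  add_mem' := fun {f g} hf hg =>
    ⟨hf.1.add hg.1, (tsupport_add (f := (f : R3 → ℂ)) (g := g)).trans
      (Set.union_subset hf.2 hg.2)⟩
  smul_mem' := fun c f hf =>
    ⟨hf.1.smul_left (f := fun _ => c), (tsupport_smul_subset_right (fun _ => c) f).trans hf.2⟩

variable {Ω : Set R3}

theorem testSpace_of_tsupport_subset {f g : 𝓢(R3, ℂ)} (hf : f ∈ testSpace Ω)
    (h : tsupport g ⊆ tsupport f) : g ∈ testSpace Ω :=
  ⟨hf.1.of_isClosed_subset (isClosed_tsupport _) h, h.trans hf.2⟩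

theorem lineDeriv_mem_testSpace {f : 𝓢(R3, ℂ)} (hf : f ∈ testSpace Ω) (m : R3) :
    ∂_{m} f ∈ testSpace Ω :=
  testSpace_of_tsupport_subset hf (tsupport_lineDerivOp_subset m f)

theorem laplacian_mem_testSpace {f : 𝓢(R3, ℂ)} (hf : f ∈ testSpace Ω) : Δ f ∈ testSpace Ω := by
  rw [laplacian_eq_sum (EuclideanSpace.basisFun (Fin 3) ℝ)]
  exact Submodule.sum_mem _ fun i _ => lineDeriv_mem_testSpace (lineDeriv_mem_testSpace hf _) _

/-- The Laplacian on `C₀^∞(Ω)`. -/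
noncomputable def lap : testSpace Ω →ₗ[ℂ] testSpace Ω :=
  ((laplacianCLM ℂ R3 𝓢(R3, ℂ) : 𝓢(R3, ℂ) →L[ℂ] 𝓢(R3, ℂ)) : 𝓢(R3, ℂ) →ₗ[ℂ] 𝓢(R3, ℂ)).restrict
    fun f hf => by simpa using laplacian_mem_testSpace hf

/-- The derivative in the first coordinate on `C₀^∞(Ω)`. -/
noncomputable def der : testSpace Ω →ₗ[ℂ] testSpace Ω :=
  ((lineDerivOpCLM ℂ 𝓢(R3, ℂ) e0 : 𝓢(R3, ℂ) →L[ℂ] 𝓢(R3, ℂ)) : 𝓢(R3, ℂ) →ₗ[ℂ] 𝓢(R3, ℂ)).restrict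
    fun f hf => by simpa using lineDeriv_mem_testSpace hf e0

theorem coe_lap (f : testSpace Ω) : (lap f : 𝓢(R3, ℂ)) = Δ (f : 𝓢(R3, ℂ)) :=
  laplacianCLM_eq ℂ (f : 𝓢(R3, ℂ))

theorem coe_der (f : testSpace Ω) : (der f : 𝓢(R3, ℂ)) = ∂_{e0} (f : 𝓢(R3, ℂ)) := rfl

theorem contDiff_exp_coord (a : ℂ) : ContDiff ℝ ∞ fun x : R3 => Complex.exp (a * (x 0 : ℝ)) := by
  have : ContDiff ℝ ∞ fun x : R3 => ((x 0 : ℝ) : ℂ) :=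
    Complex.ofRealCLM.contDiff.comp (EuclideanSpace.proj (0 : Fin 3) : R3 →L[ℝ] ℝ).contDiff
  exact (contDiff_const.mul this).cexp

/-- Multiplication by `exp (a x₀)` on `C₀^∞(Ω)`. -/
noncomputable def expMul (a : ℂ) : testSpace Ω →ₗ[ℂ] testSpace Ω where
  toFun f := ⟨HasCompactSupport.toSchwartzMap
      (f := fun x => Complex.exp (a * (x 0 : ℝ)) * (f : 𝓢(R3, ℂ)) x) f.2.1.mul_left
      ((contDiff_exp_coord a).mul (f : 𝓢(R3, ℂ)).smooth'),
    testSpace_of_tsupport_subset f.2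
      (tsupport_mul_subset_right (f := fun x : R3 => Complex.exp (a * (x 0 : ℝ))))⟩
  map_add' f g := by
    ext x
    exact mul_add _ _ _
  map_smul' c f := by
    ext x
    exact mul_left_comm _ _ _

theorem expMul_apply (a : ℂ) (f : testSpace Ω) (x : R3) :
    (expMul a f : 𝓢(R3, ℂ)) x = Complex.exp (a * (x 0 : ℝ)) * (f : 𝓢(R3, ℂ)) x := rfl

theorem lineDeriv_expMul_apply (a : ℂ) (f : testSpace Ω) (m x : R3) :
    ∂_{m} (expMul a f : 𝓢(R3, ℂ)) x = Complex.exp (a * (x 0 : ℝ)) *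
      (∂_{m} (f : 𝓢(R3, ℂ)) x + a * (m 0 : ℝ) * (f : 𝓢(R3, ℂ)) x) := by
  have h0 : HasFDerivAt (fun x : R3 => a * ((x 0 : ℝ) : ℂ))
      (a • (Complex.ofRealCLM.comp (EuclideanSpace.proj (0 : Fin 3) : R3 →L[ℝ] ℝ))) x :=
    (Complex.ofRealCLM.hasFDerivAt.comp x
      (EuclideanSpace.proj (0 : Fin 3) : R3 →L[ℝ] ℝ).hasFDerivAt).const_mul a
  have h1 := h0.cexp.mul ((f : 𝓢(R3, ℂ)).hasFDerivAt x)
  rw [lineDerivOp_apply_eq_fderiv, lineDerivOp_apply_eq_fderiv]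
  rw [show fderiv ℝ (expMul a f : 𝓢(R3, ℂ)) x = _ from h1.fderiv]
  simp
  ring

theorem der_expMul (a : ℂ) (f : testSpace Ω) :
    der (expMul a f) = expMul a (der f + a • f) := by
  ext x
  rw [coe_der, lineDeriv_expMul_apply, expMul_apply]
  simp [coe_der, e0]

theorem lap_expMul (a : ℂ) (f : testSpace Ω) :
    lap (expMul a f) = expMul a (lap f + (2 * a) • der f + a ^ 2 • f) := by
  ext x
  have h2 : ∀ m : R3, ∂_{m} (∂_{m} (expMul a f : 𝓢(R3, ℂ))) x = Complex.exp (a * (x 0 : ℝ)) *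
      (∂_{m} (∂_{m} (f : 𝓢(R3, ℂ))) x + 2 * a * (m 0 : ℝ) * ∂_{m} (f : 𝓢(R3, ℂ)) x
        + (a * (m 0 : ℝ)) ^ 2 * (f : 𝓢(R3, ℂ)) x) := fun m => by
    have e : ∂_{m} (expMul a f : 𝓢(R3, ℂ)) = (expMul a
        ((⟨∂_{m} (f : 𝓢(R3, ℂ)), lineDeriv_mem_testSpace f.2 m⟩ : testSpace Ω)
          + (a * (m 0 : ℝ)) • f) : testSpace Ω) := by
      ext y
      rw [lineDeriv_expMul_apply, expMul_apply]
      simp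
    rw [e, lineDeriv_expMul_apply]
    simp only [Submodule.coe_add, Submodule.coe_smul, lineDerivOp_add, lineDerivOp_smul]
    simp
    ring
  rw [coe_lap, expMul_apply, laplacian_eq_sum (EuclideanSpace.basisFun (Fin 3) ℝ),
    Fin.sum_univ_three]
  simp only [add_apply, h2, Submodule.coe_add, Submodule.coe_smul, coe_lap, coe_der,
    laplacian_eq_sum (EuclideanSpace.basisFun (Fin 3) ℝ), Fin.sum_univ_three, smul_apply]
  simp [e0]
  ring

/-- The inclusion `C₀^∞(Ω) → L²`. -/
noncomputable def incl : testSpace Ω →ₗ[ℂ] L2 := toL2 ∘ₗ (testSpace Ω).subtype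

theorem incl_eq (f : testSpace Ω) : incl f = toL2 (f : 𝓢(R3, ℂ)) := rfl

theorem norm_incl_expMul_I (k : ℝ) (f : testSpace Ω) :
    ‖incl (expMul (Complex.I * k) f)‖ = ‖incl f‖ := by
  have h : ∀ x : R3, ‖Complex.exp (Complex.I * k * (x 0 : ℝ))‖ = 1 := fun x => by
    rw [Complex.norm_exp]; simp
  refine le_antisymm ?_ ?_
  all_goals
    refine (norm_toL2_le_of_norm_le (c := 1) fun x => le_of_eq ?_).trans_eq (one_mul _)
    simp [expMul_apply, h]

/-- The commutator of the bilaplacian with an exponential is of lower order in the frequency. -/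
theorem lap_lap_expMul (a : ℂ) (f : testSpace Ω) :
    lap (lap (expMul a f)) - a ^ 4 • expMul a f = expMul a
      (lap (lap f) + (2 * a) • (lap (der f) + der (lap f)) + (4 * a ^ 2) • der (der f)
        + (2 * a ^ 2) • lap f + (4 * a ^ 3) • der f) := by
  rw [lap_expMul, lap_expMul]
  simp only [map_add, map_smul]
  module

/-- Carleman estimate for the Laplacian with a linear weight. -/
theorem carleman_lap {R : ℝ} (hR : 0 ≤ R) (hΩ : ∀ x ∈ Ω, |x 0| ≤ R) {τ : ℝ} (hτ : 0 ≤ τ)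
    (f : testSpace Ω) :
    τ * ‖incl (expMul τ f)‖ ≤ R * ‖incl (expMul τ (lap f))‖ := by
  set ψ := expMul (τ : ℂ) f with hψ
  have h1 := norm_lineDeriv_le_conj_laplacian τ (ψ : 𝓢(R3, ℂ))
  have hsupp : ∀ (g : testSpace Ω) (x : R3), (g : 𝓢(R3, ℂ)) x ≠ 0 → |x 0| ≤ R := fun g x hx =>
    hΩ x (g.2.2 (subset_tsupport _ hx))
  have h2 := norm_le_lineDeriv_of_slab hR (ψ : 𝓢(R3, ℂ)) (hsupp ψ) (hsupp (der ψ))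
  -- The left side is `exp(τ x₀) Δ exp(-τ x₀)` applied to `ψ`. The factor `2τ` in `h1` cancels the
  -- `2` of the Poincaré constant `2R`.
  have h3 : lap ψ - (2 * τ : ℂ) • der ψ + (τ ^ 2 : ℂ) • ψ = expMul (τ : ℂ) (lap f) := by
    rw [hψ, lap_expMul, der_expMul]
    simp only [map_add, map_smul]
    module
  rw [← coe_lap, ← coe_der, ← Submodule.coe_smul, ← Submodule.coe_smul, ← Submodule.coe_sub,
    ← Submodule.coe_add, h3, abs_of_nonneg hτ] at h1
  rw [← coe_der] at h2
  simp only [← incl_eq] at h1 h2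
  nlinarith [mul_le_mul_of_nonneg_left h2 hτ, mul_le_mul_of_nonneg_left h1 hR]

theorem carleman_lap_lap {R : ℝ} (hR : 0 ≤ R) (hΩ : ∀ x ∈ Ω, |x 0| ≤ R) {τ : ℝ} (hτ : 0 ≤ τ)
    (f : testSpace Ω) :
    τ ^ 2 * ‖incl (expMul τ f)‖ ≤ R ^ 2 * ‖incl (expMul τ (lap (lap f)))‖ := by
  nlinarith [mul_le_mul_of_nonneg_left (carleman_lap hR hΩ hτ f) hτ,
    mul_le_mul_of_nonneg_left (carleman_lap hR hΩ hτ (lap f)) hR]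

theorem inner_incl_lap (f g : testSpace Ω) :
    inner ℂ (incl f) (incl (lap g)) = inner ℂ (incl (lap f)) (incl g) := by
  simp only [incl_eq, coe_lap]
  exact inner_laplacian_right _ _

/-- The Laplacian in the Sobolev bound is interpolated by `‖Δf‖² = ⟨f, Δ²f⟩ ≤ ‖f‖ ‖Δ²f‖`. -/
theorem exists_sup_le_graph : ∃ C, 0 ≤ C ∧ ∀ (f : testSpace Ω) (x : R3),
    ‖(f : 𝓢(R3, ℂ)) x‖ ≤ C * (‖incl f‖ + ‖incl (lap (lap f))‖) := by
  obtain ⟨C, hC, h⟩ := exists_sup_le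
  refine ⟨2 * C, by positivity, fun f x => (h f x).trans ?_⟩
  rw [mul_assoc, mul_left_comm]
  refine mul_le_mul_of_nonneg_left ?_ hC
  rw [← coe_lap, map_sub, ← incl_eq, ← incl_eq]
  have h1 : ‖incl (lap f)‖ ^ 2 ≤ ‖incl f‖ * ‖incl (lap (lap f))‖ := by
    have h2 := inner_incl_lap f (lap f)
    rw [inner_self_eq_norm_sq_to_K] at h2
    calc ‖incl (lap f)‖ ^ 2 = ‖((‖incl (lap f)‖ : ℂ)) ^ 2‖ := by simp
      _ = ‖inner ℂ (incl f) (incl (lap (lap f)))‖ := by rw [h2]; rfl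
      _ ≤ _ := norm_inner_le_norm _ _
  have h3 := norm_sub_le (incl f) (incl (lap f))
  have h4 : ‖incl (lap f)‖ ≤ ‖incl f‖ + ‖incl (lap (lap f))‖ := by
    refine abs_le_of_sq_le_sq' ?_ (by positivity) |>.2
    nlinarith [norm_nonneg (incl f), norm_nonneg (incl (lap (lap f)))]
  nlinarith [norm_nonneg (incl (lap (lap f)))]

end TestSpace

/-! ### Smallness from a Hilbert-Schmidt bound -/

section HilbertSchmidt

variable {H : Type*} [NormedAddCommGroup H] [InnerProductSpace ℂ H]
variable {L : Type*} [NormedAddCommGroup L] [InnerProductSpace ℂ L]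
variable {D : Type*} [AddCommGroup D] [Module ℂ D]

/-- A Hilbert-Schmidt bound on orthonormal families from a dense subspace makes an operator small on
subspaces of finite codimension. -/
theorem smallOnFiniteCodim_of_sum_le {j : D →ₗ[ℂ] H} (hj : DenseRange j) {U : H →L[ℂ] L} {C : ℝ}
    (hC : ∀ (n : ℕ) (g : Fin n → D), Orthonormal ℂ (fun i => j (g i)) →
      ∑ i, ‖U (j (g i))‖ ^ 2 ≤ C) : SmallOnFiniteCodim U := by
  intro ε hε
  by_contra! hcon
  have key : ∀ n : ℕ, ∃ g : Fin n → D, Orthonormal ℂ (fun i => j (g i)) ∧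
      ∀ i, ε ≤ ‖U (j (g i))‖ := by
    intro n
    induction n with
    | zero => exact ⟨Fin.elim0, by simp, fun i => i.elim0⟩
    | succ n ih =>
      obtain ⟨g, hg, hgε⟩ := ih
      set F : Submodule ℂ H := Submodule.span ℂ (Set.range fun i => j (g i)) with hF
      have hFfin : FiniteDimensional ℂ F := FiniteDimensional.span_of_finite ℂ (Set.finite_range _)
      have hFj : F ≤ LinearMap.range j := by
        rw [hF, Submodule.span_le]
        rintro _ ⟨i, rfl⟩
        exact ⟨g i, rfl⟩
      obtain ⟨x, hxF, hx⟩ := hcon F hFfin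
      have hPx : Fᗮ.starProjection x = x := Submodule.starProjection_eq_self_iff.2 hxF
      have hopen : IsOpen {y : H | ε * ‖Fᗮ.starProjection y‖ < ‖U (Fᗮ.starProjection y)‖} :=
        isOpen_lt (by fun_prop) (by fun_prop)
      -- Approximate the bad vector from the range of `j`, then project onto `Fᗮ`. The projection
      -- stays in that range because `F` is spanned by elements of it, so the orthonormal family can
      -- be extended.
      obtain ⟨f, hf⟩ := hj.exists_mem_open hopen ⟨x, by rw [Set.mem_ofPred_eq, hPx]; exact hx⟩
      obtain ⟨f', hf'⟩ : Fᗮ.starProjection (j f) ∈ LinearMap.range j := by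
        rw [Submodule.starProjection_orthogonal_val]
        exact Submodule.sub_mem _ ⟨f, rfl⟩ (hFj (F.starProjection_apply_mem _))
      have hf'F : j f' ∈ Fᗮ := hf' ▸ Fᗮ.starProjection_apply_mem _
      have hf2 : ε * ‖j f'‖ < ‖U (j f')‖ := by rw [hf']; exact hf
      have hne : j f' ≠ 0 := fun h => by simp [h] at hf2
      have hn : 0 < ‖j f'‖ := norm_pos_iff.2 hne
      refine ⟨Matrix.vecCons ((‖j f'‖⁻¹ : ℂ) • f') g, ?_, ?_⟩
      · have e : (fun i => j (Matrix.vecCons ((‖j f'‖⁻¹ : ℂ) • f') g i)) =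
            Matrix.vecCons ((‖j f'‖⁻¹ : ℂ) • j f') fun i => j (g i) := by
          funext i
          refine Fin.cases ?_ (fun i => ?_) i <;> simp
        rw [e, orthonormal_vecCons_iff]
        refine ⟨by simp [norm_smul, hn.ne'], fun i => ?_, hg⟩
        rw [inner_smul_left, (Submodule.mem_orthogonal' F _).1 hf'F _
          (Submodule.subset_span ⟨i, rfl⟩), mul_zero]
      · refine Fin.cases ?_ (fun i => by simpa using hgε i)
        simp only [Matrix.cons_val_zero, map_smul, norm_smul, norm_inv, Complex.norm_real, norm_norm]
        rw [inv_mul_eq_div, le_div_iff₀ hn]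
        exact hf2.le
  obtain ⟨n, hn⟩ := exists_nat_gt (C / ε ^ 2)
  obtain ⟨g, hg, hgε⟩ := key n
  have h1 := hC n g hg
  have h2 : (n : ℝ) * ε ^ 2 ≤ ∑ i, ‖U (j (g i))‖ ^ 2 := by
    calc (n : ℝ) * ε ^ 2 = ∑ _i : Fin n, ε ^ 2 := by simp
      _ ≤ _ := Finset.sum_le_sum fun i _ => by gcongr; exact hgε i
  rw [div_lt_iff₀ (by positivity)] at hn
  linarith

end HilbertSchmidt

/-! ### The graph space and its compact inclusion in `L²` -/

section Graph

open SchwartzMap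
open scoped SchwartzMap

variable (Ω : Set R3)

/-- The graph of the bilaplacian on `C₀^∞(Ω)`. -/
noncomputable def graphMap : testSpace Ω →ₗ[ℂ] WithLp 2 (L2 × L2) :=
  (WithLp.linearEquiv 2 ℂ (L2 × L2)).symm.toLinearMap ∘ₗ
    ((incl ∘ₗ lap ∘ₗ lap).prod incl)

/-- The space `H₀^{P₀}(Ω)`, as the closure of the graph of the bilaplacian on `C₀^∞(Ω)`. -/
noncomputable abbrev graphSpace : Submodule ℂ (WithLp 2 (L2 × L2)) :=
  (LinearMap.range (graphMap Ω)).topologicalClosure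

noncomputable instance : CompleteSpace (graphSpace Ω) :=
  Submodule.topologicalClosure.completeSpace _

variable {Ω}

/-- The embedding of `C₀^∞(Ω)` in `H₀^{P₀}(Ω)`. -/
noncomputable def toGraph : testSpace Ω →ₗ[ℂ] graphSpace Ω :=
  (graphMap Ω).codRestrict _ fun f => Submodule.le_topologicalClosure _ ⟨f, rfl⟩

/-- The bilaplacian on `H₀^{P₀}(Ω)`. -/
noncomputable def graphP : graphSpace Ω →L[ℂ] L2 :=
  WithLp.fstL 2 ℂ L2 L2 ∘L (graphSpace Ω).subtypeL

/-- The inclusion of `H₀^{P₀}(Ω)` in `L²`. -/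
noncomputable def graphI : graphSpace Ω →L[ℂ] L2 :=
  WithLp.sndL 2 ℂ L2 L2 ∘L (graphSpace Ω).subtypeL

theorem graphP_toGraph (f : testSpace Ω) : graphP (toGraph f) = incl (lap (lap f)) := rfl

theorem graphI_toGraph (f : testSpace Ω) : graphI (toGraph f) = incl f := rfl

theorem norm_sq_graph (h : graphSpace Ω) : ‖h‖ ^ 2 = ‖graphP h‖ ^ 2 + ‖graphI h‖ ^ 2 :=
  WithLp.prod_norm_sq_eq_of_L2 (h : WithLp 2 (L2 × L2))

theorem denseRange_toGraph : DenseRange (toGraph : testSpace Ω →ₗ[ℂ] graphSpace Ω) := by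
  intro h
  rw [Metric.mem_closure_range_iff]
  intro ε hε
  have hh : (h : WithLp 2 (L2 × L2)) ∈ closure (Set.range (graphMap Ω)) := h.2
  obtain ⟨f, hf⟩ := Metric.mem_closure_range_iff.1 hh ε hε
  exact ⟨f, hf⟩

theorem norm_incl_sq (f : testSpace Ω) :
    ‖incl f‖ ^ 2 = ∫ x in Ω, ‖(f : 𝓢(R3, ℂ)) x‖ ^ 2 := by
  rw [setIntegral_eq_integral_of_forall_compl_eq_zero]
  · rw [incl_eq, toL2_eq, norm_toLp' (by simp) (by simp), ← Real.rpow_natCast,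
      ← Real.rpow_mul (by positivity)]
    simp
  · intro x hx
    have : (f : 𝓢(R3, ℂ)) x = 0 := by
      by_contra h
      exact hx (f.2.2 (subset_tsupport _ h))
    simp [this]

/-- Point evaluation is bounded in the graph norm, so by Bessel's inequality `∑ |gᵢ(x)|²` is bounded
uniformly in `x` for orthonormal families. Integration over the finite volume of `Ω` gives the
Hilbert-Schmidt bound. -/
theorem graphI_smallOnFiniteCodim (hvol : volume Ω ≠ ⊤) :
    SmallOnFiniteCodim (graphI : graphSpace Ω →L[ℂ] L2) := by
  obtain ⟨C, hC0, hC⟩ := exists_sup_le_graph (Ω := Ω)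
  have hsup : ∀ (f : testSpace Ω) (x : R3), ‖(f : 𝓢(R3, ℂ)) x‖ ≤ 2 * C * ‖toGraph f‖ := by
    intro f x
    refine (hC f x).trans ?_
    have h0 := norm_sq_graph (toGraph f)
    rw [graphP_toGraph, graphI_toGraph] at h0
    have h1 : ‖incl f‖ ≤ ‖toGraph f‖ :=
      (abs_le_of_sq_le_sq' (by nlinarith [sq_nonneg ‖incl (lap (lap f))‖]) (norm_nonneg _)).2
    have h2 : ‖incl (lap (lap f))‖ ≤ ‖toGraph f‖ :=
      (abs_le_of_sq_le_sq' (by nlinarith [sq_nonneg ‖incl f‖]) (norm_nonneg _)).2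
    nlinarith
  refine smallOnFiniteCodim_of_sum_le denseRange_toGraph
    (C := ∫ _x in Ω, (2 * C) ^ 2) fun n g hg => ?_
  simp only [graphI_toGraph, norm_incl_sq]
  have hint : ∀ f : testSpace Ω, IntegrableOn (fun x => ‖(f : 𝓢(R3, ℂ)) x‖ ^ 2) Ω volume :=
    fun f => (((f : 𝓢(R3, ℂ)).memLp 2 volume).norm.integrable_sq).integrableOn
  rw [← integral_finsetSum _ fun i _ => hint (g i)]
  refine setIntegral_mono (integrable_finsetSum _ fun i _ => hint (g i))
    (integrableOn_const (C := (2 * C) ^ 2) hvol) fun x => ?_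
  set s : ℝ := ∑ i, ‖(g i : 𝓢(R3, ℂ)) x‖ ^ 2 with hs
  have hs0 : 0 ≤ s := by positivity
  -- With these coefficients `∑ cᵢ gᵢ` has value `s` at `x` and squared norm `s`; the evaluation
  -- bound becomes `s ≤ 2C √s`.
  set c : Fin n → ℂ := fun i => starRingEnd ℂ ((g i : 𝓢(R3, ℂ)) x) with hc
  have h1 := hsup (∑ i, c i • g i) x
  have h2 : ((∑ i, c i • g i : testSpace Ω) : 𝓢(R3, ℂ)) x = s := by
    rw [Submodule.coe_sum, sum_apply, hs]
    push_cast
    refine Finset.sum_congr rfl fun i _ => ?_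
    simp [hc, Complex.conj_mul']
  have h3 : ‖toGraph (∑ i, c i • g i)‖ ^ 2 = s := by
    have h4 := hg.inner_sum c c Finset.univ
    rw [inner_self_eq_norm_sq_to_K] at h4
    rw [map_sum]
    simp only [map_smul]
    have h5 : ∑ i, starRingEnd ℂ (c i) * c i = (s : ℂ) := by
      rw [hs]
      push_cast
      exact Finset.sum_congr rfl fun i _ => by simp [hc, Complex.mul_conj']
    rw [h5] at h4
    have h6 := congrArg Complex.re h4
    rw [Complex.ofReal_re] at h6
    rw [← h6]
    norm_cast
  rw [h2, Complex.norm_real, Real.norm_of_nonneg hs0] at h1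
  change s ≤ (2 * C) ^ 2
  rcases hs0.eq_or_lt with h | h
  · rw [← h]; positivity
  · have h7 : s ^ 2 ≤ (2 * C) ^ 2 * s := by
      calc s ^ 2 ≤ (2 * C * ‖toGraph (∑ i, c i • g i)‖) ^ 2 := by gcongr
        _ = _ := by rw [mul_pow, h3]
    nlinarith

end Graph

/-! ### Bounded real multipliers on `L²` -/

section Multiplication

/-- Multiplication by a bounded real function on `L²`. -/
noncomputable def mulOp (b : R3 → ℝ) (hb : MemLp b ⊤ volume) : L2 →L[ℂ] L2 :=
  (ContinuousLinearMap.mul ℂ ℂ).holderL volume ⊤ 2 2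
    ((show MemLp (fun x => (b x : ℂ)) ⊤ volume from hb.ofReal).toLp)

variable {b : R3 → ℝ} {hb : MemLp b ⊤ volume}

theorem coeFn_mulOp (u : L2) : mulOp b hb u =ᵐ[volume] fun x => (b x : ℂ) * u x := by
  have h1 := (ContinuousLinearMap.mul ℂ ℂ).coeFn_holder (r := 2)
    ((show MemLp (fun x => (b x : ℂ)) ⊤ volume from hb.ofReal).toLp) u
  have h2 := (show MemLp (fun x => (b x : ℂ)) ⊤ volume from hb.ofReal).coeFn_toLp
  filter_upwards [h1, h2] with x h1 h2
  refine h1.trans ?_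
  rw [h2]
  rfl

theorem inner_mulOp_left (u v : L2) :
    inner ℂ (mulOp b hb u) v = ∫ x, (b x : ℂ) * inner ℂ (u x) (v x) := by
  rw [L2.inner_def]
  refine integral_congr_ae ?_
  filter_upwards [coeFn_mulOp (hb := hb) u] with x hx
  rw [hx]
  simp
  ring

theorem inner_mulOp_comm (u v : L2) :
    inner ℂ (mulOp b hb u) v = inner ℂ u (mulOp b hb v) := by
  rw [inner_mulOp_left, L2.inner_def]
  refine integral_congr_ae ?_
  filter_upwards [coeFn_mulOp (hb := hb) v] with x hx
  rw [hx]
  simp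
  ring

theorem norm_sq_eq_integral (u : L2) : ‖u‖ ^ 2 = ∫ x, ‖u x‖ ^ 2 := by
  have h := L2.inner_def (𝕜 := ℂ) u u
  rw [inner_self_eq_norm_sq_to_K] at h
  have h2 : (fun x => inner ℂ (u x) (u x)) = fun x => ((‖u x‖ ^ 2 : ℝ) : ℂ) := by
    funext x
    rw [inner_self_eq_norm_sq_to_K]
    norm_cast
  rw [h2, integral_complex_ofReal] at h
  apply Complex.ofReal_injective
  rw [Complex.ofReal_pow]
  exact h

theorem integrable_norm_sq (u : L2) : Integrable (fun x => ‖u x‖ ^ 2) volume :=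
  (Lp.memLp u).norm.integrable_sq

theorem re_inner_mulOp (u : L2) :
    (inner ℂ (mulOp b hb u) u).re = ∫ x, b x * ‖u x‖ ^ 2 := by
  rw [inner_mulOp_left]
  have h2 : (fun x => (b x : ℂ) * inner ℂ (u x) (u x)) =
      fun x => ((b x * ‖u x‖ ^ 2 : ℝ) : ℂ) := by
    funext x
    rw [inner_self_eq_norm_sq_to_K, Complex.ofReal_mul, Complex.ofReal_pow]
    rfl
  rw [h2, integral_complex_ofReal, Complex.ofReal_re]

theorem exists_ae_norm_le (hb : MemLp b ⊤ volume) : ∃ C, ∀ᵐ x, ‖b x‖ ≤ C := by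
  have h : eLpNormEssSup b volume ≠ ⊤ := by simpa using hb.2.ne
  refine ⟨(eLpNormEssSup b volume).toReal, ?_⟩
  filter_upwards [ae_le_eLpNormEssSup (f := b) (μ := volume)] with x hx
  rw [← toReal_enorm]
  exact ENNReal.toReal_mono h hx

theorem integrable_mul_norm_sq (hb : MemLp b ⊤ volume) (u : L2) :
    Integrable (fun x => b x * ‖u x‖ ^ 2) volume := by
  obtain ⟨C, hC⟩ := exists_ae_norm_le hb
  exact (integrable_norm_sq u).bdd_mul hb.1 hC

theorem le_re_inner_mulOp {c : ℝ} (h : ∀ᵐ x, c ≤ b x) (u : L2) :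
    c * ‖u‖ ^ 2 ≤ (inner ℂ (mulOp b hb u) u).re := by
  rw [re_inner_mulOp, norm_sq_eq_integral, ← integral_const_mul]
  refine integral_mono_ae ((integrable_norm_sq u).const_mul c) (integrable_mul_norm_sq hb u) ?_
  filter_upwards [h] with x hx
  exact mul_le_mul_of_nonneg_right hx (by positivity)

theorem re_inner_mulOp_le {c : ℝ} (h : ∀ᵐ x, b x ≤ c) (u : L2) :
    (inner ℂ (mulOp b hb u) u).re ≤ c * ‖u‖ ^ 2 := by
  rw [re_inner_mulOp, norm_sq_eq_integral, ← integral_const_mul]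
  refine integral_mono_ae (integrable_mul_norm_sq hb u) ((integrable_norm_sq u).const_mul c) ?_
  filter_upwards [h] with x hx
  exact mul_le_mul_of_nonneg_right hx (by positivity)

end Multiplication

/-! ### The self-adjoint pencil and its Gårding inequality -/

section Pencil

variable {Ω : Set R3}

theorem inner_graphP_graphI (h g : graphSpace Ω) :
    inner ℂ (graphP h) (graphI g) = inner ℂ (graphI h) (graphP g) := by
  refine DenseRange.induction_on₂ (denseRange_toGraph (Ω := Ω))
    (p := fun h g => inner ℂ (graphP h) (graphI g) = inner ℂ (graphI h) (graphP g))
    (isClosed_eq (by fun_prop) (by fun_prop)) (fun f f' => ?_) h g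
  rw [graphP_toGraph, graphP_toGraph, graphI_toGraph, graphI_toGraph, inner_incl_lap,
    inner_incl_lap]

/-- `P₀ - t` on `H₀^{P₀}(Ω)`. -/
noncomputable def shiftP (t : ℝ) : graphSpace Ω →L[ℂ] L2 := graphP - (t : ℂ) • graphI

theorem shiftP_apply (t : ℝ) (h : graphSpace Ω) :
    shiftP t h = graphP h - (t : ℂ) • graphI h := rfl

/-- The operator of the form
`⟨W (P₀ - t) u, (P₀ - t) v⟩ - t ⟨(P₀ - t) u, v⟩` on `H₀^{P₀}(Ω)`. -/
noncomputable def pencil (W : L2 →L[ℂ] L2) (t : ℝ) : graphSpace Ω →L[ℂ] graphSpace Ω :=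
  ContinuousLinearMap.adjoint (shiftP t) ∘L W ∘L shiftP t
    - ContinuousLinearMap.adjoint graphI ∘L ((t : ℂ) • shiftP t)

variable {W : L2 →L[ℂ] L2}

theorem inner_pencil (t : ℝ) (h g : graphSpace Ω) :
    inner ℂ (pencil W t h) g =
      inner ℂ (W (shiftP t h)) (shiftP t g) - t * inner ℂ (shiftP t h) (graphI g) := by
  have e : pencil W t h = ContinuousLinearMap.adjoint (shiftP t) (W (shiftP t h))
    - ContinuousLinearMap.adjoint graphI ((t : ℂ) • shiftP t h) := rfl
  rw [e, inner_sub_left, ContinuousLinearMap.adjoint_inner_left,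
    ContinuousLinearMap.adjoint_inner_left, inner_smul_left, Complex.conj_ofReal]

theorem continuous_pencil : Continuous (pencil W : ℝ → graphSpace Ω →L[ℂ] graphSpace Ω) := by
  have h1 : Continuous (shiftP : ℝ → graphSpace Ω →L[ℂ] L2) := by
    unfold shiftP
    fun_prop
  have h2 : Continuous fun t : ℝ => ContinuousLinearMap.adjoint (shiftP (Ω := Ω) t) :=
    (ContinuousLinearMap.adjoint (𝕜 := ℂ) (E := graphSpace Ω) (F := L2)).continuous.comp h1
  exact (h2.clm_comp (continuous_const.clm_comp h1)).sub
    (continuous_const.clm_comp (Complex.continuous_ofReal.smul h1))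

theorem isSelfAdjoint_pencil (hW : ∀ u v, inner ℂ (W u) v = inner ℂ u (W v)) (t : ℝ) :
    IsSelfAdjoint (pencil (Ω := Ω) W t) := by
  rw [ContinuousLinearMap.isSelfAdjoint_iff_isSymmetric]
  intro h g
  change inner ℂ (pencil W t h) g = inner ℂ h (pencil W t g)
  rw [← inner_conj_symm h, inner_pencil, inner_pencil, map_sub, map_mul, inner_conj_symm,
    inner_conj_symm, Complex.conj_ofReal, hW]
  congr 2
  simp only [shiftP_apply, inner_sub_left, inner_sub_right, inner_smul_left, inner_smul_right,
    Complex.conj_ofReal, inner_graphP_graphI]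

theorem pencil_garding {w : ℝ} (hw : 0 < w) (hW : ∀ u, w * ‖u‖ ^ 2 ≤ (inner ℂ (W u) u).re)
    (t : ℝ) : ∃ c > 0, ∃ C, ∀ h : graphSpace Ω,
      c * ‖h‖ ^ 2 ≤ (inner ℂ (pencil W t h) h).re + C * ‖graphI h‖ ^ 2 := by
  refine ⟨w / 4, by positivity, w / 2 * t ^ 2 + w / 4 + t ^ 2 / (2 * w), fun h => ?_⟩
  rw [inner_pencil, Complex.sub_re, Complex.re_ofReal_mul, norm_sq_graph]
  set e := ‖shiftP t h‖
  set u := ‖graphI h‖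
  have h1 : ‖graphP h‖ ≤ e + |t| * u := by
    have : graphP h = shiftP t h + (t : ℂ) • graphI h := by rw [shiftP_apply]; abel
    rw [this]
    refine (norm_add_le _ _).trans_eq ?_
    rw [norm_smul, Complex.norm_real, Real.norm_eq_abs]
  have h2 : t * (inner ℂ (shiftP t h) (graphI h)).re ≤ |t| * (e * u) := by
    refine (le_abs_self _).trans ?_
    rw [abs_mul]
    gcongr
    exact (Complex.abs_re_le_norm _).trans (norm_inner_le_norm _ _)
  have h3 := hW (shiftP t h)
  have h4 : |t| * (e * u) ≤ w / 2 * e ^ 2 + t ^ 2 / (2 * w) * u ^ 2 := by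
    rw [← sq_abs t]
    have : w / 2 * e ^ 2 + |t| ^ 2 / (2 * w) * u ^ 2 - |t| * (e * u) =
        (w * e - |t| * u) ^ 2 / (2 * w) := by
      field_simp
      ring
    have h5 : 0 ≤ (w * e - |t| * u) ^ 2 / (2 * w) := by positivity
    linarith
  have h5 : ‖graphP h‖ ^ 2 ≤ 2 * e ^ 2 + 2 * t ^ 2 * u ^ 2 := by
    have : ‖graphP h‖ ^ 2 ≤ (e + |t| * u) ^ 2 := by gcongr
    rw [← sq_abs t]
    nlinarith [sq_nonneg (e - |t| * u)]
  nlinarith [mul_le_mul_of_nonneg_left h5 hw.le]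

end Pencil

/-! ### High-frequency quasimodes and growth of the negative index -/

section Quasimodes

open SchwartzMap
open scoped SchwartzMap

variable {Ω : Set R3}

/-- Bump functions, each equal to `1` at one of `N` distinct points and `0` at the others, are
independent. -/
theorem exists_injective_testSpace (hΩ : IsOpen Ω) (hne : Ω.Nonempty) (N : ℕ) :
    ∃ ℓ : (Fin N → ℂ) →ₗ[ℂ] testSpace Ω, Function.Injective ℓ := by
  have hinf : Ω.Infinite := by
    obtain ⟨x, hx⟩ := hne
    exact infinite_of_mem_nhds x (hΩ.mem_nhds hx)
  set p : Fin N → R3 := fun i => hinf.natEmbedding _ i with hp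
  have hpΩ : ∀ i, p i ∈ Ω := fun i => (hinf.natEmbedding _ i).2
  have hpinj : Function.Injective p := fun i j hij =>
    Fin.ext ((hinf.natEmbedding _).injective (Subtype.ext hij))
  have hφ : ∀ i, ∃ φ : testSpace Ω, ∀ j, (φ : 𝓢(R3, ℂ)) (p j) = if i = j then 1 else 0 := by
    intro i
    have hU : Ω \ ((p '' {i}ᶜ)) ∈ 𝓝 (p i) := by
      refine (hΩ.sdiff (Set.toFinite (p '' {i}ᶜ)).isClosed).mem_nhds ⟨hpΩ i, ?_⟩
      rintro ⟨j, hj, hji⟩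
      exact hj (hpinj hji)
    obtain ⟨f, hf1, hf2, hf3, -, hf5⟩ := exists_contDiff_tsupport_subset (n := ⊤) hU
    have hts : tsupport (fun x => (f x : ℂ)) ⊆ tsupport f :=
      closure_mono fun x hx h => hx (by simp [h])
    have hc : HasCompactSupport fun x => (f x : ℂ) := hf2.comp_left (g := fun r : ℝ => (r : ℂ)) rfl
    refine ⟨⟨hc.toSchwartzMap (Complex.ofRealCLM.contDiff.comp hf3), hc,
      hts.trans (hf1.trans Set.sdiff_subset)⟩, fun j => ?_⟩
    change (f (p j) : ℂ) = _
    split_ifs with h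
    · rw [← h, hf5]; rfl
    · have : p j ∉ tsupport f := fun hm => (hf1 hm).2 ⟨j, fun h' => h h'.symm, rfl⟩
      rw [image_eq_zero_of_notMem_tsupport this]; rfl
  choose φ hφ using hφ
  refine ⟨Fintype.linearCombination ℂ φ, ?_⟩
  rw [← LinearMap.ker_eq_bot, LinearMap.ker_eq_bot']
  intro c hc
  funext j
  have h1 : ((Fintype.linearCombination ℂ φ c : testSpace Ω) : 𝓢(R3, ℂ)) (p j) = c j := by
    rw [Fintype.linearCombination_apply, Submodule.coe_sum, sum_apply]
    simp [hφ]
  rw [← h1, hc]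
  rfl

theorem injective_incl : Function.Injective (incl : testSpace Ω →ₗ[ℂ] L2) := fun _ _ h =>
  Subtype.ext (SchwartzMap.injective_toLp 2 volume h)

/-- On a finite-dimensional space all linear maps are dominated by an injective one. -/
theorem exists_norm_le_of_injective {E F : Type*} [NormedAddCommGroup E] [NormedSpace ℂ E]
    [NormedAddCommGroup F] [NormedSpace ℂ F] {N : ℕ} (A : (Fin N → ℂ) →ₗ[ℂ] E)
    {B : (Fin N → ℂ) →ₗ[ℂ] F} (hB : Function.Injective B) :
    ∃ C, 0 ≤ C ∧ ∀ c, ‖A c‖ ≤ C * ‖B c‖ := by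
  obtain ⟨K, -, hK⟩ := B.exists_antilipschitzWith (LinearMap.ker_eq_bot.2 hB)
  refine ⟨‖A.toContinuousLinearMap‖ * K, by positivity, fun c => ?_⟩
  have h1 := A.toContinuousLinearMap.le_opNorm c
  have h2 := hK.le_mul_dist c 0
  rw [map_zero, dist_zero_right, dist_zero_right] at h2
  rw [mul_assoc]
  exact h1.trans (by gcongr)

/-- Modulated amplitudes are quasimodes of the bilaplacian. -/
theorem exists_quasimode_bound {N : ℕ} {ℓ : (Fin N → ℂ) →ₗ[ℂ] testSpace Ω}
    (hℓ : Function.Injective ℓ) : ∃ A, 0 ≤ A ∧ ∀ k : ℝ, 1 ≤ k → ∀ c,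
      ‖incl (lap (lap (expMul (Complex.I * k) (ℓ c)))) -
        ((k ^ 4 : ℝ) : ℂ) • incl (expMul (Complex.I * k) (ℓ c))‖ ≤ A * k ^ 3 * ‖incl (ℓ c)‖ := by
  -- The amplitudes fill a fixed finite-dimensional space, so all their derivatives are bounded by
  -- their `L²` norm independently of `k`. After cancellation of `k⁴` the highest power left is
  -- `k³`.
  have hB : Function.Injective (incl ∘ₗ ℓ) := injective_incl.comp hℓ
  obtain ⟨A1, h1, H1⟩ := exists_norm_le_of_injective (incl ∘ₗ lap ∘ₗ lap ∘ₗ ℓ) hB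
  obtain ⟨A2, h2, H2⟩ := exists_norm_le_of_injective
    (incl ∘ₗ (lap ∘ₗ der + der ∘ₗ lap) ∘ₗ ℓ) hB
  obtain ⟨A3, h3, H3⟩ := exists_norm_le_of_injective (incl ∘ₗ der ∘ₗ der ∘ₗ ℓ) hB
  obtain ⟨A4, h4, H4⟩ := exists_norm_le_of_injective (incl ∘ₗ lap ∘ₗ ℓ) hB
  obtain ⟨A5, h5, H5⟩ := exists_norm_le_of_injective (incl ∘ₗ der ∘ₗ ℓ) hB
  refine ⟨A1 + 2 * A2 + 4 * A3 + 2 * A4 + 4 * A5, by positivity, fun k hk c => ?_⟩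
  specialize H1 c
  specialize H2 c
  specialize H3 c
  specialize H4 c
  specialize H5 c
  simp only [LinearMap.comp_apply, LinearMap.add_apply] at H1 H2 H3 H4 H5
  set f := ℓ c
  have hk0 : 0 ≤ k := by linarith
  have ha : ∀ n : ℕ, ‖(Complex.I * k) ^ n‖ = k ^ n := fun n => by
    rw [norm_pow, norm_mul, Complex.norm_I, one_mul, Complex.norm_real, Real.norm_of_nonneg hk0]
  have ha1 : ‖Complex.I * (k : ℂ)‖ = k := by simpa using ha 1
  have e : ((k ^ 4 : ℝ) : ℂ) = (Complex.I * k) ^ 4 := by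
    rw [mul_pow, Complex.I_pow_four]; push_cast; ring
  rw [e, ← map_smul, ← map_sub, lap_lap_expMul, norm_incl_expMul_I]
  simp only [map_add, map_smul]
  have hk2 : k ^ 2 ≤ k ^ 3 := pow_le_pow_right₀ hk (by norm_num)
  have hk1 : k ≤ k ^ 3 := by simpa using pow_le_pow_right₀ hk (show 1 ≤ 3 by norm_num)
  have hk00 : 1 ≤ k ^ 3 := one_le_pow₀ hk
  set n := ‖incl f‖
  have hn : 0 ≤ n := norm_nonneg _
  rw [← map_add incl (lap (der f))]
  calc _ ≤ ‖incl (lap (lap f))‖ + ‖(2 * (Complex.I * (k : ℂ))) • incl (lap (der f) + der (lap f))‖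
        + ‖(4 * (Complex.I * (k : ℂ)) ^ 2) • incl (der (der f))‖
        + ‖(2 * (Complex.I * (k : ℂ)) ^ 2) • incl (lap f)‖
        + ‖(4 * (Complex.I * (k : ℂ)) ^ 3) • incl (der f)‖ :=
      norm_add_le_of_le (norm_add_le_of_le norm_add₃_le le_rfl) le_rfl
    _ ≤ k ^ 3 * (A1 * n) + 2 * k ^ 3 * (A2 * n) + 4 * k ^ 3 * (A3 * n) + 2 * k ^ 3 * (A4 * n)
        + 4 * k ^ 3 * (A5 * n) := by
      simp only [norm_smul, norm_mul (2 : ℂ), norm_mul (4 : ℂ), ha, ha1, Complex.norm_ofNat]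
      gcongr
      exact H1.trans (le_mul_of_one_le_left (by positivity) hk00)
    _ = _ := by ring

/-- The negative index of the pencil is unbounded. -/
theorem exists_ge_negIndexGE_pencil (hΩ : IsOpen Ω) (hne : Ω.Nonempty) {W : L2 →L[ℂ] L2} {δ : ℝ}
    (hδ : 0 < δ) (hW : ∀ u, (inner ℂ (W u) u).re ≤ δ⁻¹ * ‖u‖ ^ 2) (N : ℕ) (t₀ : ℝ) :
    ∃ t ≥ t₀, NegIndexGE N (pencil (Ω := Ω) W t) := by
  obtain ⟨ℓ, hℓ⟩ := exists_injective_testSpace hΩ hne N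
  obtain ⟨A, hA, hquasi⟩ := exists_quasimode_bound hℓ
  -- With `t = k⁴ / s` one gets `k⁴ - t = t δ/2`, and `x = δ/2` minimises `x²/δ - x`. The bound `16
  -- A s / δ ≤ k` makes the quasimode error at most `(δ/16) t`, leaving the form at most `(81/256 -
  -- 7/16) δ t² ‖u‖² < 0`.
  set s := 1 + δ / 2 with hs
  have hs0 : 0 < s := by positivity
  obtain ⟨k, hk1, hk2, hk3⟩ : ∃ k : ℝ, 1 ≤ k ∧ t₀ * s ≤ k ∧ 16 * A * s / δ ≤ k :=
    ⟨max 1 (max (t₀ * s) (16 * A * s / δ)), le_max_left _ _,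
      (le_max_left _ _).trans (le_max_right _ _), (le_max_right _ _).trans (le_max_right _ _)⟩
  have hk0 : 0 < k := by linarith
  set t := k ^ 4 / s with ht
  have htpos : 0 < t := by positivity
  have hts : t * s = k ^ 4 := div_mul_cancel₀ _ hs0.ne'
  refine ⟨t, ?_, toGraph ∘ₗ expMul (Complex.I * k) ∘ₗ ℓ, fun c hc => ?_⟩
  · rw [ge_iff_le, ht, le_div_iff₀ hs0]
    exact hk2.trans (by simpa using pow_le_pow_right₀ hk1 (show 1 ≤ 4 by norm_num))
  simp only [LinearMap.comp_apply]
  set f := expMul (Complex.I * k) (ℓ c) with hf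
  have hn : 0 < ‖incl f‖ := by
    rw [hf, norm_incl_expMul_I, norm_pos_iff, ne_eq,
      map_eq_zero_iff _ injective_incl, map_eq_zero_iff _ hℓ]
    exact hc
  set r := incl (lap (lap f)) - ((k ^ 4 : ℝ) : ℂ) • incl f with hr
  have hrn : ‖r‖ ≤ δ / 16 * t * ‖incl f‖ := by
    refine (hquasi k hk1 c).trans ?_
    rw [← norm_incl_expMul_I k, ← hf]
    refine mul_le_mul_of_nonneg_right ?_ hn.le
    rw [ht, mul_div_assoc', le_div_iff₀ hs0]
    rw [div_le_iff₀ hδ] at hk3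
    nlinarith [pow_pos hk0 3]
  have hE : shiftP t (toGraph f) = r + ((t * (δ / 2) : ℝ) : ℂ) • incl f := by
    rw [shiftP_apply, graphP_toGraph, graphI_toGraph, hr, ← hts, hs]
    push_cast
    module
  rw [inner_pencil, Complex.sub_re, Complex.re_ofReal_mul, graphI_toGraph]
  have h1 := hW (shiftP t (toGraph f))
  have h2 : ‖shiftP t (toGraph f)‖ ≤ 9 / 16 * δ * t * ‖incl f‖ := by
    rw [hE]
    refine (norm_add_le _ _).trans ?_
    rw [norm_smul, Complex.norm_real, Real.norm_of_nonneg (by positivity)]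
    linarith
  have h3 : 7 / 16 * δ * t * ‖incl f‖ ^ 2 ≤ (inner ℂ (shiftP t (toGraph f)) (incl f)).re := by
    rw [hE, inner_add_left, inner_smul_left, Complex.add_re, Complex.conj_ofReal,
      Complex.re_ofReal_mul]
    have h4 : (inner ℂ (incl f) (incl f)).re = ‖incl f‖ ^ 2 :=
      (norm_sq_eq_re_inner (𝕜 := ℂ) (incl f)).symm
    have h5 : -(‖r‖ * ‖incl f‖) ≤ (inner ℂ r (incl f)).re :=
      (neg_le_neg ((Complex.abs_re_le_norm _).trans (norm_inner_le_norm r (incl f)))).trans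
        (neg_abs_le _)
    rw [h4]
    nlinarith [mul_le_mul_of_nonneg_right hrn hn.le]
  have h6 : δ⁻¹ * ‖shiftP t (toGraph f)‖ ^ 2 ≤ 81 / 256 * δ * t ^ 2 * ‖incl f‖ ^ 2 := by
    calc δ⁻¹ * ‖shiftP t (toGraph f)‖ ^ 2 ≤ δ⁻¹ * (9 / 16 * δ * t * ‖incl f‖) ^ 2 := by gcongr
      _ = _ := by field_simp; ring
  have h7 := mul_le_mul_of_nonneg_left h3 htpos.le
  have h8 : 0 < δ * t ^ 2 * ‖incl f‖ ^ 2 := by positivity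
  nlinarith

end Quasimodes

/-! ### Unique continuation from the exterior -/

section UniqueContinuation

open SchwartzMap
open scoped SchwartzMap

variable {Ω : Set R3}

theorem testSpace_apply_eq_zero (f : testSpace Ω) {x : R3} (hx : x ∉ Ω) :
    (f : 𝓢(R3, ℂ)) x = 0 := by
  by_contra h
  exact hx (f.2.2 (subset_tsupport _ h))

theorem coeFn_incl (f : testSpace Ω) : incl f =ᵐ[volume] (f : 𝓢(R3, ℂ)) := coeFn_toL2 _

theorem graph_eq_zero_of_notMem (hΩ : MeasurableSet Ω) (h : graphSpace Ω) :
    ∀ᵐ x, x ∉ Ω → graphP h x = 0 ∧ graphI h x = 0 := by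
  have hb : MemLp (Ωᶜ.indicator fun _ => (1 : ℝ)) ⊤ volume :=
    (memLp_top_const 1).indicator hΩ.compl
  set X := mulOp _ hb with hX
  have hincl : ∀ f : testSpace Ω, X (incl f) = 0 := fun f => by
    refine Lp.ext ?_
    filter_upwards [coeFn_mulOp (hb := hb) (incl f), coeFn_incl f,
      Lp.coeFn_zero ℂ 2 (volume : Measure R3)] with x h1 h2 h3
    rw [hX, h1, h2, h3]
    by_cases hx : x ∈ Ω
    · simp [hx]
    · simp [testSpace_apply_eq_zero f hx]
  have h1 : X (graphP h) = 0 ∧ X (graphI h) = 0 := by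
    refine (denseRange_toGraph (Ω := Ω)).induction_on
      (p := fun h => X (graphP h) = 0 ∧ X (graphI h) = 0) h
      ((isClosed_eq (by fun_prop) (by fun_prop)).inter (isClosed_eq (by fun_prop) (by fun_prop)))
      fun f => ⟨?_, ?_⟩
    · rw [graphP_toGraph, hincl]
    · rw [graphI_toGraph, hincl]
  have key : ∀ u : L2, X u = 0 → ∀ᵐ x, x ∉ Ω → u x = 0 := fun u hu => by
    have h2 := coeFn_mulOp (hb := hb) u
    rw [← hX, hu] at h2
    filter_upwards [h2, Lp.coeFn_zero ℂ 2 (volume : Measure R3)] with x h2 h3 hx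
    rw [h3] at h2
    simpa [hx] using h2.symm
  filter_upwards [key _ h1.1, key _ h1.2] with x h2 h3 hx
  exact ⟨h2 hx, h3 hx⟩

/-- A bounded weight that agrees with `exp (τ x₀)` for `|x₀| ≤ R`. -/
noncomputable def expWeight (τ R : ℝ) (x : R3) : ℝ := Real.exp (τ * max (-R) (min R (x 0)))

theorem memLp_expWeight {τ R : ℝ} (hτ : 0 ≤ τ) (hR : 0 ≤ R) : MemLp (expWeight τ R) ⊤ volume := by
  refine memLp_top_of_bound (C := Real.exp (τ * R)) ?_ (ae_of_all _ fun x => ?_)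
  · have : Continuous (expWeight τ R) := by
      unfold expWeight
      fun_prop
    exact this.aestronglyMeasurable
  · rw [expWeight, Real.norm_eq_abs, Real.abs_exp]
    gcongr
    exact max_le (by linarith) (min_le_left _ _)

/-- Unique continuation from the exterior: a compactly supported `u` with `|Δ² u| ≤ q |u|`
vanishes. -/
theorem eq_zero_of_norm_graphP_le (hΩ : MeasurableSet Ω) (hbdd : Bornology.IsBounded Ω)
    {q : ℝ} (hq : 0 ≤ q) (h : graphSpace Ω)
    (hle : ∀ᵐ x, x ∈ Ω → ‖graphP h x‖ ≤ q * ‖graphI h x‖) : h = 0 := by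
  obtain ⟨R, hR, hΩR⟩ : ∃ R, 0 ≤ R ∧ ∀ x ∈ Ω, |x 0| ≤ R := by
    obtain ⟨R, hR0, hR⟩ := hbdd.exists_pos_norm_le
    exact ⟨R, hR0.le, fun x hx => (PiLp.norm_apply_le x 0).trans (hR x hx)⟩
  -- Chosen so that `τ² > R² q`: the Carleman estimate and the hypothesis together give `τ² ‖X h‖ ≤
  -- R² q ‖X h‖`, hence `X h = 0`.
  set τ := √(R ^ 2 * q + 1) with hτ
  have hτ0 : 0 ≤ τ := Real.sqrt_nonneg _
  have hτ2 : τ ^ 2 = R ^ 2 * q + 1 := Real.sq_sqrt (by positivity)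
  have hb := memLp_expWeight hτ0 hR
  set X := mulOp _ hb with hX
  have hXincl : ∀ f : testSpace Ω, X (incl f) = incl (expMul τ f) := fun f => by
    refine Lp.ext ?_
    filter_upwards [coeFn_mulOp (hb := hb) (incl f), coeFn_incl f, coeFn_incl (expMul (τ : ℂ) f)]
      with x h1 h2 h3
    rw [hX, h1, h2, h3, expMul_apply]
    by_cases hx : x ∈ Ω
    · have hxR := abs_le.1 (hΩR x hx)
      rw [expWeight, min_eq_right hxR.2, max_eq_right hxR.1]
      push_cast
      rfl
    · simp [testSpace_apply_eq_zero f hx]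
  -- Truncating the weight makes `X` bounded on `L²`, so the estimate passes from test functions to
  -- the closure.
  have hcarl : τ ^ 2 * ‖X (graphI h)‖ ≤ R ^ 2 * ‖X (graphP h)‖ := by
    refine (denseRange_toGraph (Ω := Ω)).induction_on
      (p := fun h => τ ^ 2 * ‖X (graphI h)‖ ≤ R ^ 2 * ‖X (graphP h)‖) h
      (isClosed_le (by fun_prop) (by fun_prop)) fun f => ?_
    rw [graphP_toGraph, graphI_toGraph, hXincl, hXincl]
    exact carleman_lap_lap hR hΩR hτ0 f
  have hle' : ∀ᵐ x, ‖graphP h x‖ ≤ q * ‖graphI h x‖ := by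
    filter_upwards [hle, graph_eq_zero_of_notMem hΩ h] with x h1 h2
    by_cases hx : x ∈ Ω
    · exact h1 hx
    · rw [(h2 hx).1, (h2 hx).2]; simp
  have hXle : ‖X (graphP h)‖ ≤ q * ‖X (graphI h)‖ := by
    refine Lp.norm_le_mul_norm_of_ae_le_mul ?_
    filter_upwards [hle', coeFn_mulOp (hb := hb) (graphP h), coeFn_mulOp (hb := hb) (graphI h)]
      with x h1 h2 h3
    rw [hX, h2, h3, norm_mul, norm_mul, mul_left_comm]
    gcongr
  have hX0 : ‖X (graphI h)‖ = 0 := by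
    rw [hτ2] at hcarl
    nlinarith [norm_nonneg (X (graphI h)), sq_nonneg R]
  have hI : graphI h = 0 := by
    refine Lp.ext ?_
    have h2 := coeFn_mulOp (hb := hb) (graphI h)
    rw [← hX, norm_eq_zero.1 hX0] at h2
    filter_upwards [h2, Lp.coeFn_zero ℂ 2 (volume : Measure R3)] with x h2 h3
    rw [h3] at h2 ⊢
    have hne : (expWeight τ R x : ℂ) ≠ 0 := by
      rw [expWeight]
      exact_mod_cast Real.exp_ne_zero _
    exact (mul_eq_zero.1 h2.symm).resolve_left hne
  have hP : ‖graphP h‖ ≤ q * ‖graphI h‖ := Lp.norm_le_mul_norm_of_ae_le_mul hle'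
  rw [hI, norm_zero, mul_zero] at hP
  have h3 := norm_sq_graph h
  rw [hI, le_antisymm hP (norm_nonneg _), norm_zero] at h3
  exact norm_eq_zero.1 (by simpa using h3)

end UniqueContinuation

/-! ### From null vectors to transmission eigenpairs -/

section Eigenvalue

open SchwartzMap
open scoped SchwartzMap

variable {Ω : Set R3}

theorem bilaplacian_testSpace (f : testSpace Ω) :
    bilaplacian (f : 𝓢(R3, ℂ)) = (lap (lap f) : 𝓢(R3, ℂ)) := by
  have h : ∀ g : testSpace Ω, (Laplacian.laplacian ((g : 𝓢(R3, ℂ)) : R3 → ℂ) : R3 → ℂ) =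
      ((lap g : 𝓢(R3, ℂ)) : R3 → ℂ) := fun g => by
    funext x
    rw [coe_lap, laplacian_apply]
  rw [bilaplacian, h, h]

theorem isTestFunction_testSpace (f : testSpace Ω) : IsTestFunction Ω (f : 𝓢(R3, ℂ)) :=
  ⟨(f : 𝓢(R3, ℂ)).smooth', f.2.1, f.2.2⟩

theorem IsTestFunction.exists_testSpace {φ : R3 → ℂ} (hφ : IsTestFunction Ω φ) :
    ∃ f : testSpace Ω, ((f : 𝓢(R3, ℂ)) : R3 → ℂ) = φ :=
  ⟨⟨hφ.compact.toSchwartzMap hφ.smooth, hφ.compact, hφ.subset⟩, rfl⟩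

theorem IsTestFunction.conj {φ : R3 → ℂ} (hφ : IsTestFunction Ω φ) :
    IsTestFunction Ω (Complex.conjCLE ∘ φ) where
  smooth := Complex.conjCLE.contDiff.comp hφ.smooth
  compact := hφ.compact.comp_left (map_zero _)
  subset := (tsupport_comp_subset (map_zero Complex.conjCLE) φ).trans hφ.subset

theorem bilaplacian_conj (φ : R3 → ℂ) :
    bilaplacian (Complex.conjCLE ∘ φ) = Complex.conjCLE ∘ bilaplacian φ := by
  rw [bilaplacian, bilaplacian, InnerProductSpace.laplacian_CLE_comp_left,
    InnerProductSpace.laplacian_CLE_comp_left]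

theorem inner_incl_eq_integral (f : testSpace Ω) (a : L2) :
    inner ℂ (incl f) a = ∫ x, a x * starRingEnd ℂ ((f : 𝓢(R3, ℂ)) x) := by
  rw [L2.inner_def]
  refine integral_congr_ae ?_
  filter_upwards [coeFn_incl f] with x hx
  rw [hx]
  rfl

theorem integrable_mul_conj_testSpace (f : testSpace Ω) (a : L2) :
    Integrable (fun x => a x * starRingEnd ℂ ((f : 𝓢(R3, ℂ)) x)) volume := by
  have h1 : MemLp (fun x => starRingEnd ℂ ((f : 𝓢(R3, ℂ)) x)) 2 volume :=
    ((f : 𝓢(R3, ℂ)).memLp 2 volume).star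
  exact (Lp.memLp a).integrable_mul h1

theorem inner_shiftP_toGraph (t : ℝ) (f : testSpace Ω) (a : L2) :
    inner ℂ (shiftP t (toGraph f)) a = ∫ x, a x *
      (starRingEnd ℂ ((lap (lap f) : 𝓢(R3, ℂ)) x) - t * starRingEnd ℂ ((f : 𝓢(R3, ℂ)) x)) := by
  rw [shiftP_apply, graphP_toGraph, graphI_toGraph, inner_sub_left, inner_smul_left,
    inner_incl_eq_integral, inner_incl_eq_integral, Complex.conj_ofReal, ← integral_const_mul,
    ← integral_sub (integrable_mul_conj_testSpace _ _)
      ((integrable_mul_conj_testSpace _ _).const_mul _)]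
  congr 1
  funext x
  ring

theorem memH0_graphI (h : graphSpace Ω) : MemH0 Ω (graphI h) := by
  refine ⟨(Lp.memLp _).restrict _, ?_⟩
  obtain ⟨s, hs, hsh⟩ := mem_closure_iff_seq_limit.1 (denseRange_toGraph (Ω := Ω) h)
  choose f hf using hs
  refine ⟨fun j => (f j : 𝓢(R3, ℂ)), fun j => isTestFunction_testSpace _, fun η hη => ?_, ?_⟩
  · have hc : CauchySeq fun j => graphP (s j) :=
      ((graphP.continuous.tendsto h).comp hsh).cauchySeq
    obtain ⟨N, hN⟩ := EMetric.cauchySeq_iff.1 hc η hη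
    refine ⟨N, fun j hj k hk => ?_⟩
    have e : normP (((f j : 𝓢(R3, ℂ)) : R3 → ℂ) - (f k : 𝓢(R3, ℂ))) =
        edist (graphP (s j)) (graphP (s k)) := by
      have e1 : ((f j : 𝓢(R3, ℂ)) : R3 → ℂ) - (f k : 𝓢(R3, ℂ)) =
        ((f j - f k : testSpace Ω) : 𝓢(R3, ℂ)) := rfl
      rw [normP, e1, bilaplacian_testSpace, edist_eq_enorm_sub, ← map_sub, ← hf, ← hf, ← map_sub,
        graphP_toGraph, Lp.enorm_def]
      exact eLpNorm_congr_ae (coeFn_incl _).symm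
    rw [e]
    exact hN j hj k hk
  · have h1 : Tendsto (fun j => ‖graphI (s j) - graphI h‖ₑ) atTop (𝓝 0) := by
      have h2 : Tendsto (fun j => graphI (s j) - graphI h) atTop (𝓝 0) := by
        rw [← sub_self (graphI h)]
        exact ((graphI.continuous.tendsto h).comp hsh).sub_const _
      simpa using h2.enorm
    refine tendsto_of_tendsto_of_tendsto_of_le_of_le tendsto_const_nhds h1 (fun _ => zero_le)
      fun j => ?_
    refine (eLpNorm_restrict_le _ _ _ _).trans (le_of_eq ?_)
    rw [← hf, graphI_toGraph, Lp.enorm_def]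
    refine eLpNorm_congr_ae ?_
    filter_upwards [coeFn_incl (f j), Lp.coeFn_sub (incl (f j)) (graphI h)] with x h3 h4
    rw [h4, Pi.sub_apply, Pi.sub_apply, h3]

variable {V b : R3 → ℝ} {hb : MemLp b ⊤ volume} {M t : ℝ} {h : graphSpace Ω}

theorem coeFn_shiftP (t : ℝ) (h : graphSpace Ω) :
    ∀ᵐ x, shiftP t h x = graphP h x - t * graphI h x := by
  filter_upwards [Lp.coeFn_sub (graphP h) ((t : ℂ) • graphI h),
    Lp.coeFn_smul (t : ℂ) (graphI h)] with x h1 h2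
  rw [shiftP_apply, h1, Pi.sub_apply, h2, Pi.smul_apply, smul_eq_mul]

/-- The second function of a transmission eigenpair, recovered from the difference `h`. -/
noncomputable def transmitted (b : R3 → ℝ) (hb : MemLp b ⊤ volume) (t : ℝ) (h : graphSpace Ω) :
    L2 :=
  (-(t : ℂ)⁻¹) • mulOp b hb (shiftP t h)

theorem coeFn_transmitted (hb : MemLp b ⊤ volume) (t : ℝ) (h : graphSpace Ω) :
    ∀ᵐ x, transmitted b hb t h x = -(t : ℂ)⁻¹ * mulOp b hb (shiftP t h) x := by
  filter_upwards [Lp.coeFn_smul (-(t : ℂ)⁻¹) (mulOp b hb (shiftP t h))] with x h1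
  rw [transmitted, h1, Pi.smul_apply, smul_eq_mul]

theorem coeFn_transmitted' (hb : MemLp b ⊤ volume) (t : ℝ) (h : graphSpace Ω) :
    ∀ᵐ x, transmitted b hb t h x =
      -(t : ℂ)⁻¹ * (b x * (graphP h x - t * graphI h x)) := by
  filter_upwards [coeFn_transmitted hb t h, coeFn_mulOp (hb := hb) (shiftP t h),
    coeFn_shiftP t h] with x h1 h2 h3
  rw [h1, h2, h3]

/-- If `w = 0`, then `P h = t h` on `Ω` because `b ≠ 0` there, and unique continuation gives `h =
0`. -/
theorem transmitted_ne_zero (hΩ : MeasurableSet Ω) (hbdd : Bornology.IsBounded Ω)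
    (hbV : ∀ᵐ x, x ∈ Ω → b x ≠ 0 ∧ b x * V x = 1 ∧ |V x| ≤ M) (ht : 0 < t) (hne : h ≠ 0) :
    ¬ (transmitted b hb t h : R3 → ℂ) =ᵐ[volume.restrict Ω] 0 := by
  intro hw0
  have htc : (t : ℂ) ≠ 0 := by exact_mod_cast ht.ne'
  refine hne (eq_zero_of_norm_graphP_le hΩ hbdd ht.le h ?_)
  rw [EventuallyEq, ae_restrict_iff' hΩ] at hw0
  filter_upwards [hw0, coeFn_transmitted' hb t h, hbV] with x h1 h2 h5 hx
  have h8 := h1 hx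
  rw [h2, Pi.zero_apply, mul_eq_zero, mul_eq_zero] at h8
  have h9 : graphP h x - t * graphI h x = 0 := by
    rcases h8 with h8 | h8 | h8
    · exact absurd h8 (neg_ne_zero.2 (inv_ne_zero htc))
    · exact absurd (by exact_mod_cast h8) (h5 hx).1
    · exact h8
  rw [sub_eq_zero.1 h9, norm_mul, Complex.norm_real, Real.norm_of_nonneg ht.le]

/-- If `v = 0`, then `w = -h`, which unravels to `P h = t (1 + V) h` on `Ω`; the bound on `V` allows
unique continuation. -/
theorem add_transmitted_ne_zero (hΩ : MeasurableSet Ω) (hbdd : Bornology.IsBounded Ω)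
    (hbV : ∀ᵐ x, x ∈ Ω → b x ≠ 0 ∧ b x * V x = 1 ∧ |V x| ≤ M) (ht : 0 < t) (hne : h ≠ 0) :
    ¬ (fun x => graphI h x + transmitted b hb t h x) =ᵐ[volume.restrict Ω] 0 := by
  intro hv
  have htc : (t : ℂ) ≠ 0 := by exact_mod_cast ht.ne'
  refine hne (eq_zero_of_norm_graphP_le hΩ hbdd (q := t * (1 + |M|)) (by positivity) h ?_)
  rw [EventuallyEq, ae_restrict_iff' hΩ] at hv
  filter_upwards [hv, coeFn_transmitted' hb t h, hbV] with x h1 h2 h5 hx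
  obtain ⟨-, h6, h7⟩ := h5 hx
  have h6' : (b x : ℂ) * V x = 1 := by exact_mod_cast h6
  have h8 : graphI h x + transmitted b hb t h x = 0 := h1 hx
  rw [h2] at h8
  generalize graphI h x = u at h8 ⊢
  generalize graphP h x = p at h8 ⊢
  have h9 : p = t * (1 + V x) * u := by
    linear_combination (-t * V x : ℂ) * h8 + (p - t * u) * (-h6' - b x * V x * inv_mul_cancel₀ htc)
  rw [h9, norm_mul, norm_mul, Complex.norm_real, Real.norm_of_nonneg ht.le]
  gcongr
  refine (norm_add_le _ _).trans ?_
  rw [norm_one, Complex.norm_real, Real.norm_eq_abs]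
  exact add_le_add_right (h7.trans (le_abs_self M)) 1

/-- The weak equations pair bilinearly, the `L²` inner product sesquilinearly; conjugating the test
function passes between them. -/
theorem IsTestFunction.exists_conj {φ : R3 → ℂ} (hφ : IsTestFunction Ω φ) :
    ∃ f : testSpace Ω, (∀ x, φ x = starRingEnd ℂ ((f : 𝓢(R3, ℂ)) x)) ∧
      ∀ x, bilaplacian φ x = starRingEnd ℂ ((lap (lap f) : 𝓢(R3, ℂ)) x) := by
  obtain ⟨f, hf⟩ := hφ.conj.exists_testSpace
  refine ⟨f, fun x => ?_, fun x => ?_⟩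
  · rw [hf]; simp
  · rw [← bilaplacian_testSpace, hf, bilaplacian_conj]; simp

theorem integrable_mul_conj_shift (t : ℝ) (f : testSpace Ω) (c : L2) : Integrable (fun x => c x *
    (starRingEnd ℂ ((lap (lap f) : 𝓢(R3, ℂ)) x) - t * starRingEnd ℂ ((f : 𝓢(R3, ℂ)) x)))
    volume := by
  refine ((integrable_mul_conj_testSpace (lap (lap f)) c).sub
    ((integrable_mul_conj_testSpace f c).const_mul (t : ℂ))).congr (ae_of_all _ fun x => ?_)
  simp only [Pi.sub_apply]
  ring

theorem inner_shiftP_mulOp (hker : pencil (mulOp b hb) t h = 0) (f : testSpace Ω) :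
    inner ℂ (shiftP t (toGraph f)) (mulOp b hb (shiftP t h)) =
      t * inner ℂ (incl f) (shiftP t h) := by
  have h1 := inner_pencil (W := mulOp b hb) t h (toGraph f)
  rw [hker, inner_zero_left, graphI_toGraph] at h1
  have h2 := congrArg (starRingEnd ℂ) (sub_eq_zero.1 h1.symm)
  rwa [map_mul, inner_conj_symm, inner_conj_symm, Complex.conj_ofReal] at h2

theorem inner_shiftP_toGraph_graphI (t : ℝ) (f : testSpace Ω) (h : graphSpace Ω) :
    inner ℂ (shiftP t (toGraph f)) (graphI h) = inner ℂ (incl f) (shiftP t h) := by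
  rw [shiftP_apply, shiftP_apply, inner_sub_left, inner_graphP_graphI, graphI_toGraph,
    inner_sub_right, inner_smul_left, inner_smul_right, Complex.conj_ofReal]

/-- The kernel equation says weakly that `(P - t) w = -(P - t) h`, so the two contributions to `(P -
t) v` cancel. -/
theorem solvesWeakly_add_transmitted (ht : t ≠ 0) (hker : pencil (mulOp b hb) t h = 0) :
    SolvesWeakly Ω (fun _ => (t : ℂ)) fun x => graphI h x + transmitted b hb t h x := by
  intro φ hφ
  have htc : (t : ℂ) ≠ 0 := by exact_mod_cast ht
  obtain ⟨f, hf1, hf2⟩ := hφ.exists_conj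
  simp only [hf1, hf2, add_mul]
  rw [setIntegral_eq_integral_of_forall_compl_eq_zero]
  · rw [integral_add (integrable_mul_conj_shift t f _) (integrable_mul_conj_shift t f _),
      ← inner_shiftP_toGraph, ← inner_shiftP_toGraph, transmitted, inner_smul_right,
      inner_shiftP_mulOp hker, inner_shiftP_toGraph_graphI, ← mul_assoc, neg_mul,
      inv_mul_cancel₀ htc]
    ring
  · intro x hx
    rw [testSpace_apply_eq_zero _ hx, testSpace_apply_eq_zero _ hx]
    simp

/-- By the kernel equation `(P - t) w = -(P - t) h`, and this equals `t V w` on `Ω` since `b V = 1`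
there. -/
theorem solvesWeakly_transmitted (hΩ : MeasurableSet Ω) (hbV : ∀ᵐ x, x ∈ Ω → b x * V x = 1)
    (ht : t ≠ 0) (hker : pencil (mulOp b hb) t h = 0) :
    SolvesWeakly Ω (fun x => (t : ℂ) * (1 + (V x : ℂ))) (transmitted b hb t h) := by
  intro φ hφ
  have htc : (t : ℂ) ≠ 0 := by exact_mod_cast ht
  obtain ⟨f, hf1, hf2⟩ := hφ.exists_conj
  have e : ∀ᵐ x ∂(volume.restrict Ω), transmitted b hb t h x *
      (bilaplacian φ x - (t : ℂ) * (1 + (V x : ℂ)) * φ x) =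
      -(t : ℂ)⁻¹ * (mulOp b hb (shiftP t h) x * (starRingEnd ℂ ((lap (lap f) : 𝓢(R3, ℂ)) x)
        - t * starRingEnd ℂ ((f : 𝓢(R3, ℂ)) x)))
        + shiftP t h x * starRingEnd ℂ ((f : 𝓢(R3, ℂ)) x) := by
    rw [ae_restrict_iff' hΩ]
    filter_upwards [coeFn_transmitted hb t h, coeFn_mulOp (hb := hb) (shiftP t h), hbV]
      with x h3 h4 h5 hx
    have h6' : (b x : ℂ) * V x = 1 := by exact_mod_cast h5 hx
    rw [h3, h4, hf1, hf2]
    generalize shiftP t h x = s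
    generalize starRingEnd ℂ ((f : 𝓢(R3, ℂ)) x) = c
    linear_combination (s * c) * ((t : ℂ)⁻¹ * t * h6' + inv_mul_cancel₀ htc)
  rw [integral_congr_ae e, setIntegral_eq_integral_of_forall_compl_eq_zero]
  · rw [integral_add ((integrable_mul_conj_shift t f _).const_mul _)
        (integrable_mul_conj_testSpace f _),
      integral_const_mul, ← inner_shiftP_toGraph, ← inner_incl_eq_integral,
      inner_shiftP_mulOp hker, ← mul_assoc, neg_mul, inv_mul_cancel₀ htc]
    ring
  · intro x hx
    rw [testSpace_apply_eq_zero _ hx, testSpace_apply_eq_zero _ hx]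
    simp

/-- Null vectors of the pencil give transmission eigenvalues. -/
theorem isTransmissionEigenvalue_of_pencil_eq_zero (hΩ : MeasurableSet Ω)
    (hbdd : Bornology.IsBounded Ω)
    (hbV : ∀ᵐ x, x ∈ Ω → b x ≠ 0 ∧ b x * V x = 1 ∧ |V x| ≤ M) (ht : 0 < t)
    (hne : h ≠ 0) (hker : pencil (mulOp b hb) t h = 0) :
    IsTransmissionEigenvalue Ω V (t : ℂ) := by
  refine ⟨fun x => graphI h x + transmitted b hb t h x, transmitted b hb t h, fun K _ _ => ?_,
    fun K _ _ => (Lp.memLp _).restrict K, add_transmitted_ne_zero hΩ hbdd hbV ht hne,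
    transmitted_ne_zero hΩ hbdd hbV ht hne, solvesWeakly_add_transmitted ht.ne' hker,
    solvesWeakly_transmitted hΩ (hbV.mono fun x hx hxΩ => (hx hxΩ).2.1) ht.ne' hker, ?_⟩
  · exact ((Lp.memLp (graphI h)).restrict K).add ((Lp.memLp (transmitted b hb t h)).restrict K)
  · have e : (fun x => graphI h x + transmitted b hb t h x) - (transmitted b hb t h : R3 → ℂ) =
        graphI h := by
      funext x
      exact add_sub_cancel_right _ _
    rw [e]
    exact memH0_graphI h

end Eigenvalue

end Biharmonic

/-! ### Assembly of the proof -/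

open Biharmonic in
theorem proposition7p1
    (Ω : Set Biharmonic.R3) (hΩ_open : IsOpen Ω) (hΩ_conn : IsConnected Ω)
    (hΩ_bdd : Bornology.IsBounded Ω)
    (V : Biharmonic.R3 → ℝ) (hV : MemLp V ⊤ volume)
    (hV_supp : Biharmonic.essSupport V = closure Ω)
    (δ : ℝ) (hδ : 0 < δ) (hV_lower : ∀ᵐ x ∂(volume.restrict (closure Ω)), δ ≤ V x) :
    {lam : ℝ | Biharmonic.IsTransmissionEigenvalue Ω V (lam : ℂ)}.Infinite := by
  classical
  have hlow : ∀ᵐ x, x ∈ Ω → δ ≤ V x := by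
    rw [← ae_restrict_iff' hΩ_open.measurableSet]
    exact ae_restrict_of_ae_restrict_of_subset subset_closure hV_lower
  obtain ⟨M, hM⟩ := exists_ae_norm_le hV
  -- The multiplier acts on `L²` of the whole space, so `V` is replaced by `δ` off `Ω` to keep its
  -- reciprocal between positive constants almost everywhere.
  set V' : R3 → ℝ := Ω.piecewise V fun _ => δ with hV'
  have hV'm : AEStronglyMeasurable V' volume :=
    hV.1.restrict.piecewise hΩ_open.measurableSet aestronglyMeasurable_const
  have hV'l : ∀ᵐ x, δ ≤ V' x := by
    filter_upwards [hlow] with x hx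
    by_cases h : x ∈ Ω
    · simpa [hV', h] using hx h
    · simp [hV', h]
  have hV'u : ∀ᵐ x, V' x ≤ max M δ := by
    filter_upwards [hM] with x hx
    by_cases h : x ∈ Ω
    · simpa [hV', h] using Or.inl ((le_abs_self _).trans hx)
    · simp [hV', h]
  have hbl : ∀ᵐ x, (max M δ)⁻¹ ≤ (V' x)⁻¹ := by
    filter_upwards [hV'l, hV'u] with x h1 h2
    exact inv_anti₀ (hδ.trans_le h1) h2
  have hbu : ∀ᵐ x, (V' x)⁻¹ ≤ δ⁻¹ := by
    filter_upwards [hV'l] with x h1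
    exact inv_anti₀ hδ h1
  have hb : MemLp (fun x => (V' x)⁻¹) ⊤ volume := by
    refine memLp_top_of_bound hV'm.aemeasurable.inv.aestronglyMeasurable δ⁻¹ ?_
    filter_upwards [hbu, hV'l] with x h1 h2
    rwa [Real.norm_of_nonneg (inv_nonneg.2 (hδ.le.trans h2))]
  have hbV : ∀ᵐ x, x ∈ Ω → (V' x)⁻¹ ≠ 0 ∧ (V' x)⁻¹ * V x = 1 ∧ |V x| ≤ M := by
    filter_upwards [hlow, hM] with x h1 h2 hx
    have h3 : V' x = V x := by simp [hV', hx]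
    have h4 : V x ≠ 0 := (hδ.trans_le (h1 hx)).ne'
    rw [h3]
    exact ⟨inv_ne_zero h4, inv_mul_cancel₀ h4, h2⟩
  have hdeg := exists_ge_ker_ne_bot
    (graphI_smallOnFiniteCodim (Ω := Ω) hΩ_bdd.measure_lt_top.ne)
    (continuous_pencil (W := mulOp _ hb))
    (isSelfAdjoint_pencil inner_mulOp_comm)
    (pencil_garding (w := (max M δ)⁻¹) (by positivity) (le_re_inner_mulOp hbl))
    (exists_ge_negIndexGE_pencil hΩ_open hΩ_conn.nonempty hδ (re_inner_mulOp_le hbu))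
  refine Set.infinite_of_not_bddAbove fun ⟨B, hB⟩ => ?_
  obtain ⟨t, ht, h, hne, hker⟩ := hdeg (max 1 (B + 1))
  have ht1 : 1 ≤ t := (le_max_left _ _).trans ht
  have ht2 : B + 1 ≤ t := (le_max_right _ _).trans ht
  have := hB (isTransmissionEigenvalue_of_pencil_eq_zero hΩ_open.measurableSet hΩ_bdd hbV (by linarith) hne hker)
  linarith
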